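/- Let $p,q\in\mathbb{C}$ with $|p|<1$ and $q\neq 0$. For $x\in\mathbb{C}\setminus\{0\}$ put $$E(x)=E(x;p)=\prod_{k=0}^{\infty}(1-xp^k)(1-p^{k+1}/x),\qquad (x;q,p)_m=\prod_{k=0}^{m-1}E(xq^k;p)\quad(m\ge 0),$$ $(x_1,\dots,x_s;q,p)_m=(x_1;q,p)_m\cdots(x_s;q,p)_m$, and define the (terminating) very-well-poised elliptic hypergeometric series by $${_{10}\omega_9}(a_1;a_4,\dots,a_{10};q,p)=\sum_{k=0}^{\infty}\frac{E(a_1q^{2k})}{E(a_1)}\,\frac{(a_1,a_4,\dots,a_{10};q,p)_k\,q^k}{(q,a_1q/a_4,\dots,a_1q/a_{10};q,p)_k},$$ where one of $a_4,\dots,a_{10}$ is of the form $q^{-N}$ with $N\ge0$ an integer, and the sum is read as the finite sum over $0\le k\le N$. **Theorem.** Let $n\ge 0$ be an integer and let $a,b,c,d,e$ be nonzero complex numbers with $bcd=aq$ and $de=a^2q^{3n+1}$. Let $f=a/b$ or $f=a/e$. Assume that none of the denominators in the terms $0\le k\le n$ of the two sums below, nor the denominator of the prefactor on the right-hand side, vanishes.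 Then $$\sum_{k=0}^n \frac{E(aq^{4k})}{E(a)}\,\frac{(b,c;q,p)_k}{(aq^3/b,aq^3/c;q^3,p)_k}\,\frac{(d;q,p)_{2k}}{(aq/d;q,p)_{2k}}\,\frac{(e,q^{-3n};q^3,p)_k}{(aq/e,aq^{3n+1};q,p)_k}\,q^k$$ $$=\frac{(aq^3,\;a^2q^3/bce,\;a^2q^3/bdef,\;afq^3/cd;\;q^3,p)_n}{(a^2q^3/bef,\;afq^3/c,\;aq^3/d,\;a^2q^3/bcde;\;q^3,p)_n}\;{_{10}\omega_9}(af/c;\,a/c,\,fq^3/c,\,bef/a,\,d,\,dq,\,f,\,q^{-3n};\,q^3,p).$$ -/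

import Mathlib

/-- The infinite shifted factorial `(x; p)_∞ = ∏_{k ≥ 0} (1 - x p ^ k)`, for `|p| < 1`. -/
noncomputable def infShifted (x p : ℂ) : ℂ := ∏' k : ℕ, (1 - x * p ^ k)

/-- The elliptic function `E(x; p) = (x; p)_∞ (p / x; p)_∞`, for `x ≠ 0` and `|p| < 1`. -/
noncomputable def ellE (x p : ℂ) : ℂ := infShifted x p * infShifted (p / x) p

/-- The elliptic shifted factorial `(a; q, p)_n = ∏_{k < n} E(a q ^ k; p)`, for `n ≥ 0`. -/
noncomputable def ellFac (a q p : ℂ) (n : ℕ) : ℂ := ∏ k ∈ Finset.range n, ellE (a * q ^ k) p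

/-- The condensed notation `(a₁, …, a_m; q, p)_n = (a₁; q, p)_n ⋯ (a_m; q, p)_n`. -/
noncomputable def ellFacs (l : List ℂ) (q p : ℂ) (n : ℕ) : ℂ :=
  (l.map fun a => ellFac a q p n).prod

/-- The very-well-poised elliptic hypergeometric series
`_{r+1}ω_r(a₁; a₄, …, a_{r+1}; q, p)`, where `l` is the list `[a₄, …, a_{r+1}]`.
It is used for terminating series only: one entry of `l` is `q ^ (-n)`, so that the summand
vanishes for `k > n` and the sum is finite. -/
noncomputable def ellOmega (a₁ : ℂ) (l : List ℂ) (q p : ℂ) : ℂ :=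
  ∑' k : ℕ, ellE (a₁ * q ^ (2 * k)) p / ellE a₁ p *
    (ellFacs (a₁ :: l) q p k * q ^ k /
      ellFacs (q :: l.map fun x => a₁ * q / x) q p k)

open Filter Topology

section ThetaProduct

variable {p : ℂ}

theorem summable_norm_mul_pow (hp : ‖p‖ < 1) (x : ℂ) : Summable fun k : ℕ => ‖-(x * p ^ k)‖ := by
  simp only [norm_neg, norm_mul, norm_pow]
  exact (summable_geometric_of_lt_one (norm_nonneg _) hp).mul_left _

theorem multipliable_infShifted (hp : ‖p‖ < 1) (x : ℂ) :
    Multipliable fun k : ℕ => 1 - x * p ^ k := by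
  simpa only [sub_eq_add_neg] using multipliable_one_add_of_summable (summable_norm_mul_pow hp x)

theorem tendsto_infShifted (hp : ‖p‖ < 1) (x : ℂ) :
    Tendsto (fun N => ∏ k ∈ Finset.range N, (1 - x * p ^ k)) atTop (𝓝 (infShifted x p)) :=
  (multipliable_infShifted hp x).hasProd.tendsto_prod_nat

theorem infShifted_ne_zero (hp : ‖p‖ < 1) {x : ℂ} (h : ∀ k : ℕ, 1 - x * p ^ k ≠ 0) :
    infShifted x p ≠ 0 := by
  have := tprod_one_add_ne_zero_of_summable (f := fun k : ℕ => -(x * p ^ k))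
    (fun k => by simpa [sub_eq_add_neg] using h k) (summable_norm_mul_pow hp x)
  simpa only [infShifted, sub_eq_add_neg] using this

theorem infShifted_eq_mul (hp : ‖p‖ < 1) (x : ℂ) :
    infShifted x p = (1 - x) * infShifted (x * p) p := by
  refine tendsto_nhds_unique ((tendsto_infShifted hp x).comp (tendsto_add_atTop_nat 1))
    (((tendsto_infShifted hp (x * p)).const_mul (1 - x)).congr fun N => ?_)
  simp only [Function.comp_apply, Finset.prod_range_succ', pow_zero, mul_one, pow_succ', mul_assoc]
  ring

theorem continuous_infShifted (hp : ‖p‖ < 1) : Continuous fun x => infShifted x p := by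
  rw [continuous_iff_continuousAt]
  intro x
  have h := Summable.hasProdLocallyUniformlyOn_nat_one_add (K := Metric.ball (0 : ℂ) (‖x‖ + 1))
    (f := fun (k : ℕ) (y : ℂ) => -(y * p ^ k)) Metric.isOpen_ball
    ((summable_geometric_of_lt_one (norm_nonneg _) hp).mul_left (‖x‖ + 1))
    (.of_forall fun k y hy => by
      simp only [norm_neg, norm_mul, norm_pow]
      gcongr
      simpa using (Metric.mem_ball.1 hy).le)
    (fun k => by fun_prop)
  rw [hasProdLocallyUniformlyOn_iff_tendstoLocallyUniformlyOn] at h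
  have hc := h.continuousOn (Frequently.of_forall fun s => by fun_prop)
  simp only [← sub_eq_add_neg] at hc
  exact hc.continuousAt (Metric.isOpen_ball.mem_nhds (by simp))

theorem continuousAt_ellE (hp : ‖p‖ < 1) {x : ℂ} (hx : x ≠ 0) :
    ContinuousAt (fun x => ellE x p) x := by
  unfold ellE
  exact (continuous_infShifted hp).continuousAt.mul
    (ContinuousAt.comp (f := fun x => p / x) (g := fun y => infShifted y p)
      (continuous_infShifted hp).continuousAt (continuousAt_const.div continuousAt_id hx))

theorem ellE_one (hp : ‖p‖ < 1) : ellE 1 p = 0 := by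
  rw [ellE, infShifted_eq_mul hp 1]; simp

theorem ellE_inv (hp : ‖p‖ < 1) {x : ℂ} (hx : x ≠ 0) : ellE x⁻¹ p = -x⁻¹ * ellE x p := by
  rw [ellE, ellE, infShifted_eq_mul hp x, infShifted_eq_mul hp x⁻¹]
  have h1 : p / x⁻¹ = x * p := by field_simp
  have h2 : p / x = x⁻¹ * p := by field_simp
  rw [h1, h2]
  field_simp
  ring

theorem countable_ellE_zeros (hp : ‖p‖ < 1) : {x : ℂ | x ≠ 0 ∧ ellE x p = 0}.Countable := by
  refine ((Set.countable_range fun k : ℕ => (p ^ k)⁻¹).union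
    (Set.countable_range fun k : ℕ => p * p ^ k)).mono ?_
  rintro x ⟨hx, h⟩
  by_contra hn
  simp only [Set.mem_union, Set.mem_range, not_or, not_exists] at hn
  refine mul_ne_zero (infShifted_ne_zero hp fun k hk => ?_) (infShifted_ne_zero hp fun k hk => ?_) h
  · exact hn.1 k (eq_inv_of_mul_eq_one_left (sub_eq_zero.1 hk).symm).symm
  · apply hn.2 k
    field_simp at hk
    linear_combination -hk

end ThetaProduct

section TripleProduct

variable {p : ℂ}

/-- The finite product `(p; p)_k`. -/
noncomputable def eulerProd (p : ℂ) (k : ℕ) : ℂ := ∏ i ∈ Finset.range k, (1 - p * p ^ i)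

theorem one_sub_pow_succ_ne_zero (hp : ‖p‖ < 1) (k : ℕ) : 1 - p * p ^ k ≠ 0 := by
  intro h
  have h1 : ‖p ^ (k + 1)‖ = 1 := by rw [pow_succ', ← sub_eq_zero.1 h, norm_one]
  rw [norm_pow] at h1
  exact (pow_lt_one₀ (norm_nonneg p) hp k.succ_ne_zero).ne h1

theorem eulerProd_ne_zero (hp : ‖p‖ < 1) (k : ℕ) : eulerProd p k ≠ 0 :=
  Finset.prod_ne_zero_iff.2 fun i _ => one_sub_pow_succ_ne_zero hp i

theorem eulerProd_succ (k : ℕ) : eulerProd p (k + 1) = eulerProd p k * (1 - p * p ^ k) :=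
  Finset.prod_range_succ _ _

theorem tendsto_eulerProd (hp : ‖p‖ < 1) :
    Tendsto (eulerProd p) atTop (𝓝 (infShifted p p)) :=
  tendsto_infShifted hp p

theorem infShifted_self_ne_zero (hp : ‖p‖ < 1) : infShifted p p ≠ 0 :=
  infShifted_ne_zero hp (one_sub_pow_succ_ne_zero hp)

/-- The finite `q`-binomial theorem. -/
theorem prod_one_sub_mul_pow (hp : ‖p‖ < 1) (y : ℂ) (M : ℕ) :
    ∏ k ∈ Finset.range M, (1 - y * p ^ k) =
      ∑ j ∈ Finset.range (M + 1), eulerProd p M / (eulerProd p j * eulerProd p (M - j)) *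
        ((-1) ^ j * p ^ (j.choose 2) * y ^ j) := by
  induction M with
  | zero => simp [eulerProd]
  | succ M ih =>
    have h0 := eulerProd_ne_zero hp
    have h1 := one_sub_pow_succ_ne_zero hp
    set A : ℕ → ℂ := fun j => eulerProd p M / (eulerProd p j * eulerProd p (M - j)) *
        ((-1) ^ j * p ^ (j.choose 2) * y ^ j) with hA
    have key : ∀ j ∈ Finset.range M, eulerProd p (M + 1) /
        (eulerProd p (j + 1) * eulerProd p (M + 1 - (j + 1))) *
        ((-1) ^ (j + 1) * p ^ ((j + 1).choose 2) * y ^ (j + 1)) =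
        A (j + 1) - y * p ^ M * A j := by
      intro j hj
      obtain ⟨i, rfl⟩ := Nat.exists_eq_add_of_lt (Finset.mem_range.1 hj)
      have e1 : j + i + 1 - (j + 1) = i := by omega
      have e2 : j + i + 1 - j = i + 1 := by omega
      have e3 : j + i + 1 + 1 - (j + 1) = i + 1 := by omega
      have e4 : (j + 1).choose 2 = j + j.choose 2 := by
        rw [Nat.choose_succ_succ' j 1, Nat.choose_one_right]
      simp only [hA, e1, e2, e3, e4, eulerProd_succ]
      have := h0 i; have := h0 j; have := h1 i; have := h1 j; have := h0 (j + i)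
      have := h1 (j + i)
      field_simp
      ring
    rw [Finset.prod_range_succ, ih]
    have hs1 := Finset.sum_range_succ' A M
    have hs2 := Finset.sum_range_succ A M
    generalize Finset.sum (Finset.range (M + 1)) A = S at hs1 hs2 ⊢
    rw [Finset.sum_range_succ _ (M + 1), Finset.sum_range_succ' _ M,
      Finset.sum_congr rfl key, Finset.sum_sub_distrib, ← Finset.mul_sum]
    have e5 : eulerProd p (M + 1) / (eulerProd p 0 * eulerProd p (M + 1 - 0)) *
        ((-1) ^ 0 * p ^ (Nat.choose 0 2) * y ^ 0) = A 0 := by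
      have h00 : eulerProd p 0 = 1 := rfl
      simp [hA, h00, h0]
    have e6 : eulerProd p (M + 1) / (eulerProd p (M + 1) * eulerProd p (M + 1 - (M + 1))) *
        ((-1) ^ (M + 1) * p ^ ((M + 1).choose 2) * y ^ (M + 1)) = - (y * p ^ M * A M) := by
      have e4 : (M + 1).choose 2 = M + M.choose 2 := by
        rw [Nat.choose_succ_succ' M 1, Nat.choose_one_right]
      have := h0 M; have := h0 (M + 1); have := h0 0
      simp only [hA, e4, Nat.sub_self]
      field_simp
      ring
    rw [e5, e6]
    linear_combination (-(y * p ^ M)) * hs2 + hs1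

/-- The Laurent coefficients `(-1) ^ m p ^ (m (m - 1) / 2)` of the theta function. -/
noncomputable def thetaCoeff (p : ℂ) (m : ℤ) : ℂ := (-1) ^ m * p ^ (m * (m - 1) / 2)

theorem thetaCoeff_add_one (hp0 : p ≠ 0) (m : ℤ) :
    thetaCoeff p (m + 1) = -p ^ m * thetaCoeff p m := by
  have e : (m + 1) * (m + 1 - 1) / 2 = m * (m - 1) / 2 + m := by
    rw [show (m + 1) * (m + 1 - 1) = m * (m - 1) + m * 2 by ring,
      Int.add_mul_ediv_right _ _ two_ne_zero]
  rw [thetaCoeff, thetaCoeff, e, zpow_add₀ hp0, zpow_add₀ (by norm_num : (-1 : ℂ) ≠ 0)]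
  ring

theorem finite_triple_product (hp : ‖p‖ < 1) (hp0 : p ≠ 0) {x : ℂ} (hx : x ≠ 0) (N : ℕ) :
    (∏ k ∈ Finset.range N, (1 - x * p ^ k)) * ∏ k ∈ Finset.range N, (1 - p / x * p ^ k) =
      ∑ j ∈ Finset.range (2 * N + 1),
        eulerProd p (2 * N) / (eulerProd p j * eulerProd p (2 * N - j)) *
          (thetaCoeff p (j - N) * x ^ ((j : ℤ) - N)) := by
  set s : ℂ := ∏ k ∈ Finset.range N, (-x * (p ^ (k + 1))⁻¹) with hs
  have hs0 : s ≠ 0 := Finset.prod_ne_zero_iff.2 fun k _ => by simp [hx, hp0]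
  have hbase : s * (thetaCoeff p (-N) * x ^ (-(N : ℤ))) = 1 := by
    rw [hs]
    clear hs hs0 s
    induction N with
    | zero => simp [thetaCoeff]
    | succ N ih =>
      have h := thetaCoeff_add_one hp0 (-((N + 1 : ℕ) : ℤ))
      rw [show -((N + 1 : ℕ) : ℤ) + 1 = -(N : ℤ) by push_cast; ring] at h
      rw [h] at ih
      rw [Finset.prod_range_succ, ← ih]
      rw [show -((N + 1 : ℕ) : ℤ) = -(N : ℤ) + -1 by push_cast; ring, zpow_add₀ hx, zpow_add₀ hp0,
        zpow_neg p, zpow_natCast, zpow_neg_one, zpow_neg_one, pow_succ]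
      field_simp
  have hterm : ∀ j : ℕ, (-1) ^ j * p ^ (j.choose 2) * (x * (p ^ N)⁻¹) ^ j =
      s * (thetaCoeff p (j - N) * x ^ ((j : ℤ) - N)) := by
    intro j
    induction j with
    | zero => simpa using hbase.symm
    | succ j ih =>
      have e4 : (j + 1).choose 2 = j + j.choose 2 := by
        rw [Nat.choose_succ_succ' j 1, Nat.choose_one_right]
      rw [show ((j + 1 : ℕ) : ℤ) - N = (j - N : ℤ) + 1 by push_cast; ring, thetaCoeff_add_one hp0,
        zpow_add₀ hx, zpow_one, e4, zpow_sub₀ hp0, zpow_natCast, zpow_natCast]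
      linear_combination (-x * p ^ j / p ^ N) * ih
  have hb := prod_one_sub_mul_pow hp (x * (p ^ N)⁻¹) (2 * N)
  rw [two_mul N, Finset.prod_range_add] at hb
  have h1 : ∏ k ∈ Finset.range N, (1 - x * (p ^ N)⁻¹ * p ^ k) =
      s * ∏ k ∈ Finset.range N, (1 - p / x * p ^ k) := by
    rw [← Finset.prod_range_reflect, hs, ← Finset.prod_mul_distrib]
    refine Finset.prod_congr rfl fun k hk => ?_
    have hk := Finset.mem_range.1 hk
    have : p ^ N = p ^ (N - 1 - k) * p ^ (k + 1) := by rw [← pow_add]; congr 1; omega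
    rw [this]
    field_simp
    ring
  have h2 : ∀ k, (1 - x * (p ^ N)⁻¹ * p ^ (N + k)) = 1 - x * p ^ k := by
    intro k; rw [pow_add]; field_simp
  rw [h1] at hb
  simp only [h2, hterm] at hb
  rw [← two_mul] at hb
  apply mul_left_cancel₀ hs0
  rw [Finset.mul_sum]
  rw [← sub_eq_zero] at hb ⊢
  rw [← hb]
  congr 1
  · ring
  · exact Finset.sum_congr rfl fun j _ => by ring

theorem summable_thetaCoeff (hp : ‖p‖ < 1) (hp0 : p ≠ 0) {x : ℂ} (hx : x ≠ 0) :
    Summable fun m : ℤ => ‖thetaCoeff p m * x ^ m‖ := by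
  have hne : ∀ m : ℤ, thetaCoeff p m ≠ 0 := fun m =>
    mul_ne_zero (zpow_ne_zero _ (by norm_num)) (zpow_ne_zero _ hp0)
  have ht : ∀ y : ℝ, Tendsto (fun n : ℕ => ‖p‖ ^ n * y) atTop (𝓝 0) := fun y => by
    simpa using (tendsto_pow_atTop_nhds_zero_of_lt_one (norm_nonneg p) hp).mul_const y
  refine Summable.of_nat_of_neg ?_ ?_
  · refine summable_of_ratio_test_tendsto_lt_one (l := 0) zero_lt_one
      (.of_forall fun n => by simp [hne, hx]) ((ht ‖x‖).congr fun n => ?_)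
    have := hne n
    rw [norm_norm, norm_norm, ← norm_div]
    push_cast
    rw [thetaCoeff_add_one hp0, zpow_add₀ hx]
    rw [show -p ^ (n : ℤ) * thetaCoeff p n * (x ^ (n : ℤ) * x ^ (1 : ℤ)) /
      (thetaCoeff p n * x ^ (n : ℤ)) = -(p ^ n * x) by
        have := zpow_ne_zero (n : ℤ) hx
        rw [zpow_natCast p, zpow_one]
        field_simp]
    simp
  · refine summable_of_ratio_test_tendsto_lt_one (l := 0) zero_lt_one
      (.of_forall fun n => by simp [hne, hx]) ((ht (‖p‖ * ‖x‖⁻¹)).congr fun n => ?_)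
    have h := thetaCoeff_add_one hp0 (-((n + 1 : ℕ) : ℤ))
    rw [show -((n + 1 : ℕ) : ℤ) + 1 = -(n : ℤ) by push_cast; ring] at h
    rw [norm_norm, norm_norm, ← norm_div]
    have h3 := hne (-((n + 1 : ℕ) : ℤ))
    rw [h, show (-((n + 1 : ℕ) : ℤ)) = -(n : ℤ) + -1 by push_cast; ring, zpow_add₀ hx,
      zpow_add₀ hp0]
    rw [show -((n + 1 : ℕ) : ℤ) = -(n : ℤ) + -1 by push_cast; ring] at h3
    rw [show thetaCoeff p (-(n : ℤ) + -1) * (x ^ (-(n : ℤ)) * x ^ (-1 : ℤ)) /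
      (-(p ^ (-(n : ℤ)) * p ^ (-1 : ℤ)) * thetaCoeff p (-(n : ℤ) + -1) * x ^ (-(n : ℤ))) =
        -(p ^ n * (p * x⁻¹)) by
        have := zpow_ne_zero (-n : ℤ) hx
        rw [zpow_neg p, zpow_natCast p, zpow_neg_one, zpow_neg_one]
        field_simp]
    simp

/-- The Jacobi triple product identity. -/
theorem hasSum_ellE (hp : ‖p‖ < 1) (hp0 : p ≠ 0) {x : ℂ} (hx : x ≠ 0) :
    HasSum (fun m : ℤ => thetaCoeff p m * x ^ m) (infShifted p p * ellE x p) := by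
  have hsum := summable_thetaCoeff hp hp0 hx
  have hP := infShifted_self_ne_zero hp
  have h0 := eulerProd_ne_zero hp
  have hinv : Tendsto (fun k => (eulerProd p k)⁻¹) atTop (𝓝 (infShifted p p)⁻¹) :=
    (tendsto_eulerProd hp).inv₀ hP
  obtain ⟨C, hC⟩ := (tendsto_eulerProd hp).norm.bddAbove_range
  obtain ⟨D, hD⟩ := hinv.norm.bddAbove_range
  replace hC : ∀ k, ‖eulerProd p k‖ ≤ C := fun k => hC ⟨k, rfl⟩
  replace hD : ∀ k, ‖(eulerProd p k)⁻¹‖ ≤ D := fun k => hD ⟨k, rfl⟩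
  have hC0 : 0 ≤ C := (norm_nonneg _).trans (hC 0)
  have hD0 : 0 ≤ D := (norm_nonneg _).trans (hD 0)
  let F : ℕ → ℤ → ℂ := fun N m => if m ∈ Finset.Icc (-(N : ℤ)) N then
    eulerProd p (2 * N) * (eulerProd p (m + N).toNat)⁻¹ * (eulerProd p (N - m).toNat)⁻¹ *
      (thetaCoeff p m * x ^ m) else 0
  have hF : ∀ N, ∑' m, F N m = (∏ k ∈ Finset.range N, (1 - x * p ^ k)) *
      ∏ k ∈ Finset.range N, (1 - p / x * p ^ k) := by
    intro N
    rw [finite_triple_product hp hp0 hx, tsum_eq_sum (s := Finset.Icc (-(N : ℤ)) N)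
      (fun m hm => if_neg hm)]
    refine Finset.sum_nbij' (fun m => (m + N).toNat) (fun j => (j : ℤ) - N) ?_ ?_ ?_ ?_ ?_
    · intro m hm; simp only [Finset.mem_Icc, Finset.mem_range] at *; omega
    · intro m hm; simp only [Finset.mem_Icc, Finset.mem_range] at *; omega
    · intro m hm; simp only [Finset.mem_Icc] at *; omega
    · intro m hm; simp only [Finset.mem_range] at *; omega
    · intro m hm
      simp only [if_pos hm]
      simp only [Finset.mem_Icc] at hm
      rw [show ((m + N).toNat : ℤ) - N = m by omega,
        show 2 * N - (m + N).toNat = (N - m).toNat by omega]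
      rw [div_eq_mul_inv, mul_inv]
      ring
  have hlim : Tendsto (fun N => ∑' m, F N m) atTop
      (𝓝 (∑' m, (infShifted p p)⁻¹ * (thetaCoeff p m * x ^ m))) := by
    refine tendsto_tsum_of_dominated_convergence
      (bound := fun m => C * D * D * ‖thetaCoeff p m * x ^ m‖) (hsum.mul_left _) ?_ ?_
    · intro m
      have t1 : Tendsto (fun N : ℕ => (m + N).toNat) atTop atTop :=
        tendsto_atTop.2 fun b => by
          filter_upwards [eventually_ge_atTop (b + m.natAbs)] with N hN
          omega
      have t2 : Tendsto (fun N : ℕ => ((N : ℤ) - m).toNat) atTop atTop :=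
        tendsto_atTop.2 fun b => by
          filter_upwards [eventually_ge_atTop (b + m.natAbs)] with N hN
          omega
      have t3 : Tendsto (fun N : ℕ => 2 * N) atTop atTop :=
        tendsto_id.const_mul_atTop' two_pos
      have := ((((tendsto_eulerProd hp).comp t3).mul (hinv.comp t1)).mul (hinv.comp t2)).mul_const
        (thetaCoeff p m * x ^ m)
      rw [mul_inv_cancel₀ hP, one_mul] at this
      refine this.congr' ?_
      filter_upwards [eventually_ge_atTop m.natAbs] with N hN
      have : m ∈ Finset.Icc (-(N : ℤ)) N := by simp only [Finset.mem_Icc]; omega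
      simp only [F, if_pos this, Function.comp_apply]
    · refine .of_forall fun N m => ?_
      by_cases hm : m ∈ Finset.Icc (-(N : ℤ)) N
      · simp only [F, if_pos hm]
        rw [norm_mul, norm_mul, norm_mul]
        gcongr
        · exact hC _
        · exact hD _
        · exact hD _
      · simp only [F, if_neg hm, norm_zero]
        positivity
  have hprod := (tendsto_infShifted hp x).mul (tendsto_infShifted hp (p / x))
  simp only [hF] at hlim
  have heq := tendsto_nhds_unique hprod hlim
  have hs' : Summable fun m : ℤ => thetaCoeff p m * x ^ m := hsum.of_norm
  rw [tsum_mul_left] at heq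
  rw [ellE, heq, mul_inv_cancel_left₀ hP]
  exact hs'.hasSum

end TripleProduct

section AdditionFormula

variable {p : ℂ}

/-- The coefficient of `x ^ s` in the product of the theta functions of `x y` and `x / y`. -/
noncomputable def thetaConv (p y : ℂ) (s : ℤ) : ℂ :=
  ∑' m : ℤ, thetaCoeff p m * thetaCoeff p (s - m) * y ^ (2 * m - s)

theorem thetaConv_add_two (hp0 : p ≠ 0) (y : ℂ) (s : ℤ) :
    thetaConv p y (s + 2) = p ^ s * thetaConv p y s := by
  rw [thetaConv, thetaConv, ← tsum_mul_left, ← (Equiv.addRight (1 : ℤ)).tsum_eq]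
  refine tsum_congr fun m => ?_
  simp only [Equiv.coe_addRight]
  rw [show s + 2 - (m + 1) = s - m + 1 by ring, thetaCoeff_add_one hp0, thetaCoeff_add_one hp0,
    show 2 * (m + 1) - (s + 2) = 2 * m - s by ring, zpow_sub₀ hp0]
  have := zpow_ne_zero m hp0
  field_simp

theorem thetaConv_two_mul_add (hp0 : p ≠ 0) (y : ℂ) (t r : ℤ) :
    thetaConv p y (2 * t + r) = p ^ (t * (t - 1) + r * t) * thetaConv p y r := by
  have step : ∀ t : ℤ, thetaConv p y (2 * (t + 1) + r) =
      p ^ (2 * t + r) * thetaConv p y (2 * t + r) := fun t => by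
    rw [← thetaConv_add_two hp0]; congr 1; ring
  induction t with
  | zero => simp
  | succ t ih =>
    rw [step, ih, ← mul_assoc, ← zpow_add₀ hp0]
    congr 2
    ring
  | pred t ih =>
    have := step (-t - 1)
    rw [show -(t : ℤ) - 1 + 1 = -t by ring, ih] at this
    apply mul_left_cancel₀ (zpow_ne_zero (2 * (-(t : ℤ) - 1) + r) hp0)
    rw [← this, ← mul_assoc, ← zpow_add₀ hp0]
    congr 2
    ring

/-- The space spanned by the functions `x ↦ E(x y) E(x / y)` is two-dimensional. -/
theorem exists_ellE_mul_ellE_eq (hp : ‖p‖ < 1) (hp0 : p ≠ 0) :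
    ∃ A B C D : ℂ → ℂ, ∀ x y : ℂ, x ≠ 0 → y ≠ 0 →
      ellE (x * y) p * ellE (x / y) p = A x * C y + B x * D y := by
  have hP := infShifted_self_ne_zero hp
  refine ⟨fun x => (infShifted p p)⁻¹ ^ 2 *
      ∑' s : ℤ, if s % 2 = 0 then x ^ s * p ^ (s / 2 * (s / 2 - 1) + 0 * (s / 2)) else 0,
    fun x => (infShifted p p)⁻¹ ^ 2 *
      ∑' s : ℤ, if s % 2 = 0 then 0 else x ^ s * p ^ (s / 2 * (s / 2 - 1) + 1 * (s / 2)),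
    fun y => thetaConv p y 0, fun y => thetaConv p y 1, fun x y hx hy => ?_⟩
  have hxy := mul_ne_zero hx hy
  have hxy' := div_ne_zero hx hy
  have s1 := summable_thetaCoeff hp hp0 hxy
  have s2 := summable_thetaCoeff hp hp0 hxy'
  have hs := summable_mul_of_summable_norm s1 s2
  have hprod := (hasSum_ellE hp hp0 hxy).mul (hasSum_ellE hp hp0 hxy') hs
  let e : ℤ × ℤ ≃ ℤ × ℤ :=
    { toFun := fun z => (z.2, z.1 - z.2)
      invFun := fun z => (z.1 + z.2, z.1)
      left_inv := fun z => by ext <;> simp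
      right_inv := fun z => by ext <;> simp }
  have hterm : ∀ z : ℤ × ℤ, ((fun z : ℤ × ℤ => thetaCoeff p z.1 * (x * y) ^ z.1 *
      (thetaCoeff p z.2 * (x / y) ^ z.2)) ∘ e) z =
      x ^ z.1 * (thetaCoeff p z.2 * thetaCoeff p (z.1 - z.2) * y ^ (2 * z.2 - z.1)) := by
    rintro ⟨s, m⟩
    simp only [Function.comp_apply, e, Equiv.coe_fn_mk]
    rw [mul_zpow, div_zpow, zpow_sub₀ hx, zpow_sub₀ hy, zpow_sub₀ hy, two_mul, zpow_add₀ hy]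
    have := zpow_ne_zero m hx; have := zpow_ne_zero m hy; have := zpow_ne_zero s hy
    field_simp
  have he := (e.hasSum_iff.2 hprod)
  rw [funext hterm] at he
  have hconv : HasSum (fun s : ℤ => x ^ s * thetaConv p y s)
      (infShifted p p * ellE (x * y) p * (infShifted p p * ellE (x / y) p)) := by
    have h := he.prod_fiberwise fun s => (he.summable.prod_factor s).hasSum
    simp only [tsum_mul_left] at h
    exact h
  let F₀ : ℤ → ℂ := fun s =>
    if s % 2 = 0 then x ^ s * p ^ (s / 2 * (s / 2 - 1) + 0 * (s / 2)) else 0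
  let F₁ : ℤ → ℂ := fun s =>
    if s % 2 = 0 then 0 else x ^ s * p ^ (s / 2 * (s / 2 - 1) + 1 * (s / 2))
  have h₀ : ∀ s, Set.indicator {s : ℤ | s % 2 = 0} (fun s => x ^ s * thetaConv p y s) s =
      F₀ s * thetaConv p y 0 := fun s => by
    by_cases h : s % 2 = 0
    · rw [Set.indicator_of_mem (by exact h)]
      simp only [F₀, if_pos h]
      rw [mul_assoc, ← thetaConv_two_mul_add hp0]
      congr 2
      omega
    · rw [Set.indicator_of_notMem (by exact h)]
      simp only [F₀, if_neg h, zero_mul]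
  have h₁ : ∀ s, Set.indicator {s : ℤ | s % 2 = 0}ᶜ (fun s => x ^ s * thetaConv p y s) s =
      F₁ s * thetaConv p y 1 := fun s => by
    by_cases h : s % 2 = 0
    · rw [Set.indicator_of_notMem (show s ∉ {s : ℤ | s % 2 = 0}ᶜ from fun h' => h' h)]
      simp only [F₁, if_pos h, zero_mul]
    · rw [Set.indicator_of_mem (by exact h)]
      simp only [F₁, if_neg h]
      rw [mul_assoc, ← thetaConv_two_mul_add hp0]
      congr 2
      omega
  have hsplit := (hconv.summable.indicator {s : ℤ | s % 2 = 0}).tsum_add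
    (hconv.summable.indicator {s : ℤ | s % 2 = 0}ᶜ)
  have hadd : ∀ s, Set.indicator {s : ℤ | s % 2 = 0} (fun s => x ^ s * thetaConv p y s) s +
      Set.indicator {s : ℤ | s % 2 = 0}ᶜ (fun s => x ^ s * thetaConv p y s) s =
      x ^ s * thetaConv p y s := fun s => Set.indicator_self_add_compl_apply _ _ s
  rw [tsum_congr hadd, tsum_congr h₀, tsum_congr h₁, tsum_mul_right, tsum_mul_right,
    hconv.tsum_eq] at hsplit
  change _ = (infShifted p p)⁻¹ ^ 2 * (∑' s, F₀ s) * _ + (infShifted p p)⁻¹ ^ 2 * (∑' s, F₁ s) * _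
  rw [mul_assoc, mul_assoc, ← mul_add, ← hsplit]
  field_simp

/-- The Pfaffian of an alternating `4 × 4` matrix of rank at most two vanishes. -/
theorem pfaffian_eq_zero {ι : Type*} {W : ι → ι → ℂ} {A B C D : ι → ℂ}
    (hW : ∀ i j, W i j = A i * C j + B i * D j) (hself : ∀ i, W i i = 0)
    (hsymm : ∀ i j, W i j = -W j i) (x y u v : ι) :
    W x y * W u v - W x u * W y v + W x v * W y u = 0 := by
  have key : ∀ x y u v : ι, W x y * (W x y * W u v - W x u * W y v + W x v * W y u) = 0 := by
    intro x y u v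
    have hdet : W x x * (W y y * W u v - W y v * W u y) - W x y * (W y x * W u v - W y v * W u x) +
        W x v * (W y x * W u y - W y y * W u x) = 0 := by
      simp only [hW]; ring
    rw [hself x, hself y, hsymm y x, hsymm u x, hsymm u y] at hdet
    linear_combination hdet
  by_contra h
  have h1 := (mul_eq_zero.1 (key x y u v)).resolve_right h
  have h2 : W x u = 0 := by
    refine (mul_eq_zero.1 (key x u y v)).resolve_right fun h' => h ?_
    rw [hsymm u y] at h'
    linear_combination -h'
  have h3 : W x v = 0 := by
    refine (mul_eq_zero.1 (key x v y u)).resolve_right fun h' => h ?_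
    rw [hsymm v u, hsymm v y] at h'
    linear_combination h'
  exact h (by rw [h1, h2, h3]; ring)

/-- Weierstrass' addition formula. -/
theorem ellE_addition (hp : ‖p‖ < 1) {x y u v : ℂ} (hx : x ≠ 0) (hy : y ≠ 0) (hu : u ≠ 0)
    (hv : v ≠ 0) :
    ellE (x * y) p * ellE (x / y) p * (ellE (u * v) p * ellE (u / v) p) -
      ellE (x * v) p * ellE (x / v) p * (ellE (u * y) p * ellE (u / y) p) =
    u / y * (ellE (y * v) p * ellE (y / v) p) * (ellE (x * u) p * ellE (x / u) p) := by
  rcases eq_or_ne p 0 with rfl | hp0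
  · have h : ∀ z, ellE z 0 = 1 - z := fun z => by
      have h0 : infShifted 0 0 = 1 := by simp [infShifted]
      rw [ellE, infShifted_eq_mul hp, mul_zero, zero_div, h0]; ring
    simp only [h]
    field_simp
    ring
  obtain ⟨A, B, C, D, h⟩ := exists_ellE_mul_ellE_eq hp hp0
  have hself : ∀ a : ℂ, a ≠ 0 → A a * C a + B a * D a = 0 := fun a ha => by
    rw [← h a a ha ha, div_self ha, ellE_one hp, mul_zero]
  have key := pfaffian_eq_zero (ι := {z : ℂ // z ≠ 0})
    (W := fun a b => ellE (a * b : ℂ) p * ellE (a / b : ℂ) p / a)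
    (A := fun a => A a / a) (B := fun a => B a / a) (C := fun b => C b) (D := fun b => D b)
    (fun a b => by rw [h a b a.2 b.2]; ring)
    (fun a => by rw [div_self a.2, ellE_one hp, mul_zero, zero_div])
    (fun a b => by
      have ha := a.2
      have hb := b.2
      rw [← inv_div (b : ℂ) a, ellE_inv hp (div_ne_zero hb ha), mul_comm (b : ℂ) a]
      field_simp) ⟨x, hx⟩ ⟨y, hy⟩ ⟨u, hu⟩ ⟨v, hv⟩
  have hinv : ellE (y / u) p = -(y / u) * ellE (u / y) p := by
    rw [← inv_div u y, ellE_inv hp (div_ne_zero hu hy)]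
  simp only [hinv, mul_comm y u] at key
  field_simp at key ⊢
  linear_combination key

end AdditionFormula

section IsTheta

/-- The algebraic properties of the theta function `x ↦ E(x; p)`. -/
structure IsTheta (E : ℂ → ℂ) : Prop where
  one : E 1 = 0
  inv : ∀ {x : ℂ}, x ≠ 0 → E x⁻¹ = -x⁻¹ * E x
  add : ∀ {x y u v : ℂ}, x ≠ 0 → y ≠ 0 → u ≠ 0 → v ≠ 0 →
    E (x * y) * E (x / y) * (E (u * v) * E (u / v)) -
      E (x * v) * E (x / v) * (E (u * y) * E (u / y)) =
    u / y * (E (y * v) * E (y / v)) * (E (x * u) * E (x / u))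

theorem isTheta_ellE {p : ℂ} (hp : ‖p‖ < 1) : IsTheta fun x => ellE x p :=
  ⟨ellE_one hp, ellE_inv hp, ellE_addition hp⟩

/-- The shifted factorial `∏_{k < n} E(a q ^ k)`. -/
noncomputable def efac (E : ℂ → ℂ) (q a : ℂ) (n : ℕ) : ℂ := ∏ k ∈ Finset.range n, E (a * q ^ k)

variable {E : ℂ → ℂ} {q : ℂ}

theorem efac_zero (a : ℂ) : efac E q a 0 = 1 := rfl

theorem efac_succ (a : ℂ) (n : ℕ) : efac E q a (n + 1) = efac E q a n * E (a * q ^ n) :=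
  Finset.prod_range_succ _ _

theorem efac_succ' (a : ℂ) (n : ℕ) : efac E q a (n + 1) = E a * efac E q (a * q) n := by
  rw [efac, Finset.prod_range_succ', mul_comm, pow_zero, mul_one]
  simp only [efac, pow_succ', mul_assoc]

theorem efac_add (a : ℂ) (m n : ℕ) :
    efac E q a (m + n) = efac E q a m * efac E q (a * q ^ m) n := by
  rw [efac, Finset.prod_range_add]
  simp only [efac, pow_add, mul_assoc]

theorem efac_ne_zero {a : ℂ} {n : ℕ} (h : ∀ k < n, E (a * q ^ k) ≠ 0) : efac E q a n ≠ 0 :=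
  Finset.prod_ne_zero_iff.2 fun k hk => h k (Finset.mem_range.1 hk)

theorem ne_zero_of_efac_ne_zero {a : ℂ} {n k : ℕ} (h : efac E q a n ≠ 0) (hk : k < n) :
    E (a * q ^ k) ≠ 0 :=
  Finset.prod_ne_zero_iff.1 h k (Finset.mem_range.2 hk)

namespace IsTheta

theorem inv_div (hE : IsTheta E) {x y : ℂ} (hx : x ≠ 0) (hy : y ≠ 0) :
    E (x / y) = -(x / y) * E (y / x) := by
  rw [← _root_.inv_div y x, hE.inv (div_ne_zero hy hx)]

/-- The addition formula in well-poised form. -/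
theorem add' (hE : IsTheta E) {l x y u v : ℂ} (hl : l ≠ 0) (hx : x ≠ 0) (hy : y ≠ 0) (hu : u ≠ 0)
    (hv : v ≠ 0) :
    E (x * y) * E (l * x / y) * (E (u * v) * E (l * u / v)) -
      E (x * v) * E (l * x / v) * (E (u * y) * E (l * u / y)) =
    l * u / y * (E (y * v / l) * E (y / v)) * (E (l * x * u) * E (x / u)) := by
  obtain ⟨r, rfl⟩ := IsAlgClosed.exists_pow_nat_eq l (n := 2) two_pos
  have hr : r ≠ 0 := fun h => hl (by simp [h])
  have h := hE.add (mul_ne_zero hx hr) (div_ne_zero hy hr) (mul_ne_zero hu hr) (div_ne_zero hv hr)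
  rw [show x * r * (y / r) = x * y by field_simp, show x * r * (v / r) = x * v by field_simp,
    show u * r * (y / r) = u * y by field_simp, show u * r * (v / r) = u * v by field_simp,
    show x * r / (y / r) = r ^ 2 * x / y by field_simp,
    show x * r / (v / r) = r ^ 2 * x / v by field_simp,
    show u * r / (y / r) = r ^ 2 * u / y by field_simp,
    show u * r / (v / r) = r ^ 2 * u / v by field_simp,
    show y / r * (v / r) = y * v / r ^ 2 by field_simp,
    show y / r / (v / r) = y / v by field_simp,
    show x * r * (u * r) = r ^ 2 * x * u by ring,
    show x * r / (u * r) = x / u by field_simp] at h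
  exact h

theorem add_term (hE : IsTheta E) {a k P u q : ℂ} (ha : a ≠ 0) (hk : k ≠ 0) (hP : P ≠ 0)
    (hu : u ≠ 0) (hq : q ≠ 0) :
    E (k * P / (a * u)) * E (k * P * u) * (E (P * q) * E (a * P * q)) -
      E (k * P / a) * E (k * P) * (E (P * q / u) * E (a * P * q * u)) =
    P * q / u * (E (k * P ^ 2 * q) * E (k / (a * q))) * (E (a * u) * E u) := by
  have h := hE.add' (l := a) (x := u) (y := k * P) (u := 1) (v := a * P * q) ha hu
    (by positivity) one_ne_zero (by positivity)
  rw [hE.inv_div (x := a * u) (y := k * P) (by positivity) (by positivity),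
    hE.inv_div (x := a * 1) (y := a * P * q) (by simpa) (by positivity),
    hE.inv_div (x := a * u) (y := a * P * q) (by positivity) (by positivity),
    hE.inv_div (x := a * 1) (y := k * P) (by simpa) (by positivity),
    show k * P / (a * 1) = k * P / a by field_simp,
    show u * (k * P) = k * P * u by ring, show a * P * q / (a * 1) = P * q by field_simp,
    show 1 * (a * P * q) = a * P * q by ring, show u * (a * P * q) = a * P * q * u by ring,
    show a * P * q / (a * u) = P * q / u by field_simp, show 1 * (k * P) = k * P by ring,
    show k * P * (a * P * q) / a = k * P ^ 2 * q by field_simp,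
    show k * P / (a * P * q) = k / (a * q) by field_simp, show a * u * 1 = a * u by ring,
    show u / 1 = u by field_simp] at h
  field_simp at h ⊢
  linear_combination h

theorem add_sum (hE : IsTheta E) {a b c d k P q : ℂ} (ha : a ≠ 0) (hb : b ≠ 0) (hc : c ≠ 0)
    (hd : d ≠ 0) (hk : k ≠ 0) (hP : P ≠ 0) (hq : q ≠ 0) (hbal : b * c * d * k = a ^ 2 * q) :
    E (a * P * q) * E (k * b / a * P) * (E (k * c / a * P) * E (k * d / a * P)) -
      E (k * P / a) * E (a * q / b * P) * (E (a * q / c * P) * E (a * q / d * P)) =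
    P * (k / a) * E (k * P ^ 2 * q) * (E b * E c * E d) := by
  have h := hE.add' (l := k * b * q) (x := P) (y := a * q) (u := P / b) (v := a * q / c)
    (by positivity) (by positivity) (by positivity) (by positivity) (by positivity)
  rw [show P * (a * q) = a * P * q by ring,
    show k * b * q * P / (a * q) = k * b / a * P by field_simp,
    show P / b * (a * q / c) = k * d / a * P by field_simp; linear_combination -hbal,
    show k * b * q * (P / b) / (a * q / c) = k * c / a * P by field_simp,
    show P * (a * q / c) = a * q / c * P by ring,
    show k * b * q * P / (a * q / c) = a * q / d * P by field_simp; linear_combination hbal,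
    show P / b * (a * q) = a * q / b * P by field_simp,
    show k * b * q * (P / b) / (a * q) = k * P / a by field_simp,
    show a * q * (a * q / c) / (k * b * q) = d by field_simp; linear_combination -hbal,
    show a * q / (a * q / c) = c by field_simp,
    show k * b * q * P * (P / b) = k * P ^ 2 * q by field_simp,
    show P / (P / b) = b by field_simp] at h
  linear_combination h

end IsTheta

end IsTheta

section FrenkelTuraev

variable {E : ℂ → ℂ}

/-- The kernel `(k/a)_{n-j} (k)_{n+j} / ((q)_{n-j} (aq)_{n+j})` of well-poised Bailey pairs. -/
noncomputable def wpKernel (E : ℂ → ℂ) (q a k : ℂ) (n j : ℕ) : ℂ :=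
  efac E q (k / a) (n - j) * efac E q k (n + j) /
    (efac E q q (n - j) * efac E q (a * q) (n + j))

/-- The summand of the Frenkel–Turaev sum. -/
noncomputable def ftTerm (E : ℂ → ℂ) (q a b c d k : ℂ) (n j : ℕ) : ℂ :=
  wpKernel E q a k n j * (E (a * q ^ (2 * j)) / E a *
    (efac E q a j * efac E q b j * efac E q c j * efac E q d j /
      (efac E q q j * efac E q (a * q / b) j * efac E q (a * q / c) j * efac E q (a * q / d) j)) *
    (k / a) ^ j)

/-- The closed form of the Frenkel–Turaev sum. -/
noncomputable def ftSum (E : ℂ → ℂ) (q a b c d k : ℂ) (n : ℕ) : ℂ :=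
  efac E q k n * efac E q (k * b / a) n * efac E q (k * c / a) n * efac E q (k * d / a) n /
    (efac E q q n * efac E q (a * q / b) n * efac E q (a * q / c) n * efac E q (a * q / d) n)

/-- The nonvanishing of the denominators of the Frenkel–Turaev sum. -/
structure FTNonzero (E : ℂ → ℂ) (q a b c d : ℂ) (n : ℕ) : Prop where
  q_ne : ∀ m < n, E (q * q ^ m) ≠ 0
  a_ne : ∀ m ≤ 2 * n, E (a * q ^ m) ≠ 0
  b_ne : ∀ m < n, E (a * q / b * q ^ m) ≠ 0
  c_ne : ∀ m < n, E (a * q / c * q ^ m) ≠ 0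
  d_ne : ∀ m < n, E (a * q / d * q ^ m) ≠ 0

variable {q a b c d k : ℂ}

theorem FTNonzero.pred {n : ℕ} (h : FTNonzero E q a b c d (n + 1)) : FTNonzero E q a b c d n :=
  ⟨fun m hm => h.q_ne m (by omega), fun m hm => h.a_ne m (by omega),
    fun m hm => h.b_ne m (by omega), fun m hm => h.c_ne m (by omega),
    fun m hm => h.d_ne m (by omega)⟩

theorem FTNonzero.shift {n : ℕ} (hq : q ≠ 0) (h : FTNonzero E q a b c d (n + 1)) :
    FTNonzero E q (a * q ^ 2) (b * q) (c * q) (d * q) n := by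
  have e : ∀ x m, a * q ^ 2 * q / (x * q) * q ^ m = a * q / x * q ^ (m + 1) := fun x m => by
    rw [pow_succ q m]; field_simp
  refine ⟨fun m hm => h.q_ne m (by omega), fun m hm => ?_, fun m hm => ?_, fun m hm => ?_,
    fun m hm => ?_⟩
  · rw [mul_assoc, ← pow_add]; exact h.a_ne _ (by omega)
  · rw [e]; exact h.b_ne _ (by omega)
  · rw [e]; exact h.c_ne _ (by omega)
  · rw [e]; exact h.d_ne _ (by omega)

theorem FTNonzero.efac_q {n : ℕ} (h : FTNonzero E q a b c d n) {j : ℕ} (hj : j ≤ n) :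
    efac E q q j ≠ 0 := efac_ne_zero fun m hm => h.q_ne m (by omega)

theorem FTNonzero.efac_a {n : ℕ} (h : FTNonzero E q a b c d n) {j : ℕ} (hj : j ≤ 2 * n) :
    efac E q (a * q) j ≠ 0 := efac_ne_zero fun m hm => by
  rw [mul_assoc, ← pow_succ']; exact h.a_ne _ (by omega)

theorem FTNonzero.efac_b {n : ℕ} (h : FTNonzero E q a b c d n) {j : ℕ} (hj : j ≤ n) :
    efac E q (a * q / b) j ≠ 0 := efac_ne_zero fun m hm => h.b_ne m (by omega)

theorem FTNonzero.efac_c {n : ℕ} (h : FTNonzero E q a b c d n) {j : ℕ} (hj : j ≤ n) :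
    efac E q (a * q / c) j ≠ 0 := efac_ne_zero fun m hm => h.c_ne m (by omega)

theorem FTNonzero.efac_d {n : ℕ} (h : FTNonzero E q a b c d n) {j : ℕ} (hj : j ≤ n) :
    efac E q (a * q / d) j ≠ 0 := efac_ne_zero fun m hm => h.d_ne m (by omega)

theorem FTNonzero.E_q {n : ℕ} (h : FTNonzero E q a b c d n) {j : ℕ} (hj : j < n) :
    E (q ^ (j + 1)) ≠ 0 := by rw [pow_succ']; exact h.q_ne j hj

/-- Changing `n` in the summand. -/
theorem ftTerm_succ_left (M j : ℕ)
    (h : FTNonzero E q a b c d (M + j + 1)) :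
    ftTerm E q a b c d k (M + j + 1) j = ftTerm E q a b c d k (M + j) j *
      (E (k / a * q ^ M) * E (k * q ^ (M + 2 * j)) /
        (E (q ^ (M + 1)) * E (a * q ^ (M + 2 * j + 1)))) := by
  have h1 := h.E_q (show M < M + j + 1 by omega)
  have h2 := h.a_ne (M + 2 * j + 1) (by omega)
  have h3 := h.efac_q (show M ≤ _ by omega)
  have h4 := h.efac_a (show M + 2 * j ≤ _ by omega)
  rw [ftTerm, ftTerm, wpKernel, wpKernel, show M + j + 1 - j = M + 1 by omega,
    show M + j - j = M by omega, show M + j + 1 + j = M + 2 * j + 1 by ring,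
    show M + j + j = M + 2 * j by ring, efac_succ, efac_succ, efac_succ, efac_succ,
    ← pow_succ', mul_assoc a q, ← pow_succ']
  generalize E (q ^ (M + 1)) = x₁ at *
  generalize E (a * q ^ (M + 2 * j + 1)) = x₂ at *
  generalize efac E q q M = x₃ at *
  generalize efac E q (a * q) (M + 2 * j) = x₄ at *
  generalize E (a * q ^ (2 * j)) / E a * _ * _ = y
  clear h
  field_simp

/-- The summand with shifted parameters. -/
theorem ftTerm_shift (hq : q ≠ 0) (ha : a ≠ 0) (hk : k ≠ 0)
    (M i : ℕ) (h : FTNonzero E q a b c d (M + i + 2)) :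
    E k * E b * E c * E d *
      ftTerm E q (a * q ^ 2) (b * q) (c * q) (d * q) (k * q) (M + 1 + i) i =
    ftTerm E q a b c d k (M + (i + 1)) (i + 1) *
      (E (k / (a * q)) * E (a * q ^ (i + 1)) * E (q ^ (i + 1)) *
        (E (a * q / b) * E (a * q / c) * E (a * q / d)) * (a / (k * q ^ i)) /
          (E (q ^ (M + 1)) * E (a * q ^ (M + 2 * i + 3)))) := by
  have e : ∀ x, a * q ^ 2 * q / (x * q) = a * q / x * q := fun x => by field_simp
  have e' : ∀ x, x * q * q = x * q ^ 2 := fun x => by ring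
  have key : ∀ x m, E x * efac E q (x * q) m = efac E q x m * E (x * q ^ m) := fun x m => by
    rw [← efac_succ', efac_succ]
  have ka : E a * E (a * q) * efac E q (a * q ^ 2) i =
      efac E q a (i + 1) * E (a * q ^ (i + 1)) := by
    rw [mul_assoc, ← e', ← efac_succ', ← efac_succ', efac_succ]
  have kaq : E (a * q) * E (a * q ^ 2) * efac E q (a * q ^ 2 * q) (M + 1 + i + i) =
      efac E q (a * q) (M + 2 * i + 2) * E (a * q ^ (M + 2 * i + 3)) := by
    rw [mul_assoc, ← efac_succ', ← e', ← efac_succ', efac_succ, mul_assoc a, ← pow_succ']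
    ring_nf
  have kk : E k * efac E q (k * q) (M + 1 + i + i) = efac E q k (M + 2 * i + 2) := by
    rw [← efac_succ']; ring_nf
  have kka : efac E q (k * q / (a * q ^ 2)) (M + 1) = E (k / (a * q)) * efac E q (k / a) M := by
    rw [show k * q / (a * q ^ 2) = k / (a * q) by field_simp, efac_succ',
      show k / (a * q) * q = k / a by field_simp]
  have kq : efac E q q (M + 1) = efac E q q M * E (q ^ (M + 1)) := by
    rw [efac_succ, pow_succ']
  have kqi : efac E q q (i + 1) = efac E q q i * E (q ^ (i + 1)) := by
    rw [efac_succ, pow_succ']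
  have kx : ∀ x, efac E q x (i + 1) = E x * efac E q (x * q) i := fun x => efac_succ' _ _
  have h0 := h.a_ne 0 (by omega); rw [pow_zero, mul_one] at h0
  have h1 := h.a_ne 1 (by omega); rw [pow_one] at h1
  have h2 := h.a_ne 2 (by omega)
  have h3 := h.a_ne (M + 2 * i + 3) (by omega)
  have h4 := h.E_q (show M < _ by omega)
  have h5 := h.E_q (show i < _ by omega)
  have h6 := h.efac_q (show M ≤ _ by omega)
  have h7 := h.efac_q (show i ≤ _ by omega)
  have h8 := h.efac_a (show M + 2 * i + 2 ≤ _ by omega)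
  have hb0 := h.b_ne 0 (by omega); rw [pow_zero, mul_one] at hb0
  have hc0 := h.c_ne 0 (by omega); rw [pow_zero, mul_one] at hc0
  have hd0 := h.d_ne 0 (by omega); rw [pow_zero, mul_one] at hd0
  have hb1 := h.efac_b (show i + 1 ≤ _ by omega)
  have hc1 := h.efac_c (show i + 1 ≤ _ by omega)
  have hd1 := h.efac_d (show i + 1 ≤ _ by omega)
  rw [kx] at hb1 hc1 hd1
  replace hb1 := right_ne_zero_of_mul hb1
  replace hc1 := right_ne_zero_of_mul hc1
  replace hd1 := right_ne_zero_of_mul hd1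
  have kaq' : efac E q (a * q ^ 2 * q) (M + 1 + i + i) =
      efac E q (a * q) (M + 2 * i + 2) * E (a * q ^ (M + 2 * i + 3)) /
        (E (a * q) * E (a * q ^ 2)) := by
    rw [← kaq]; field_simp
  have ka' : efac E q (a * q ^ 2) i = efac E q a (i + 1) * E (a * q ^ (i + 1)) /
      (E a * E (a * q)) := by
    rw [← ka]; field_simp
  rw [ftTerm, ftTerm, wpKernel, wpKernel, show M + 1 + i - i = M + 1 by omega,
    show M + (i + 1) - (i + 1) = M by omega,
    show M + (i + 1) + (i + 1) = M + 2 * i + 2 by ring, e, e, e, ← kk, kka, kq, kaq', kqi, ka',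
    kx (a * q / b), kx (a * q / c), kx (a * q / d), kx b, kx c, kx d,
    show a * q ^ 2 * q ^ (2 * i) = a * q ^ (2 * (i + 1)) by ring,
    show k * q / (a * q ^ 2) = k / a / q by field_simp, div_pow (k / a) q i, pow_succ (k / a) i]
  clear kaq ka kaq' ka' kx kqi kq kka kk key e e' h
  generalize efac E q (k / a) M = w₁ at *
  generalize efac E q (k * q) (M + 1 + i + i) = w₂ at *
  generalize efac E q q M = w₃ at *
  generalize efac E q (a * q) (M + 2 * i + 2) = w₄ at *
  generalize efac E q a (i + 1) = w₅ at *
  generalize efac E q (b * q) i = w₆ at *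
  generalize efac E q (c * q) i = w₇ at *
  generalize efac E q (d * q) i = w₈ at *
  generalize efac E q q i = w₉ at *
  generalize efac E q (a * q / b * q) i = v₁ at *
  generalize efac E q (a * q / c * q) i = v₂ at *
  generalize efac E q (a * q / d * q) i = v₃ at *
  generalize E (a * q / b) = v₄ at *
  generalize E (a * q / c) = v₅ at *
  generalize E (a * q / d) = v₆ at *
  generalize E (k / (a * q)) = v₇ at *
  generalize E (q ^ (M + 1)) = v₈ at *
  generalize E (q ^ (i + 1)) = v₉ at *
  generalize E (a * q ^ (M + 2 * i + 3)) = u₁ at *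
  generalize E (a * q ^ (i + 1)) = u₂ at *
  generalize E (a * q ^ (2 * (i + 1))) = u₃ at *
  generalize E (a * q ^ 2) = u₄ at *
  generalize E (a * q) = u₅ at *
  generalize E a = u₆ at *
  generalize E b = u₇ at *
  generalize E c = u₈ at *
  generalize E d = u₉ at *
  generalize E k = u₁₀ at *
  have hqi := pow_ne_zero i hq
  have hki := pow_ne_zero i (div_ne_zero hk ha)
  generalize (k / a) ^ i = t₁ at *
  generalize q ^ i = t₂ at *
  simp only [mul_div_assoc', div_mul_eq_mul_div, div_div_eq_mul_div, div_div]
  rw [div_eq_div_iff (by positivity) (by positivity)]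
  ring

theorem ftSum_succ (hE : IsTheta E) (hq : q ≠ 0) (ha : a ≠ 0) (hb : b ≠ 0) (hc : c ≠ 0)
    (hd : d ≠ 0) (hk : k ≠ 0) (hbal : b * c * d * k = a ^ 2 * q) (N : ℕ)
    (h : FTNonzero E q a b c d (N + 1)) :
    ftSum E q a b c d k (N + 1) =
      E (k / a * q ^ N) * E (k * q ^ N) / (E (q ^ (N + 1)) * E (a * q ^ (N + 1))) *
        ftSum E q a b c d k N +
      q ^ N * (k / a) * E (k * q ^ (2 * N + 1)) * (E b * E c * E d) * E k /
        (E (q ^ (N + 1)) * E (a * q ^ (N + 1)) *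
          (E (a * q / b) * E (a * q / c) * E (a * q / d))) *
        ftSum E q (a * q ^ 2) (b * q) (c * q) (d * q) (k * q) N := by
  have e : ∀ x, a * q ^ 2 * q / (x * q) = a * q / x * q := fun x => by field_simp
  have e' : ∀ x, k * q * (x * q) / (a * q ^ 2) = k * x / a := fun x => by field_simp
  have key : ∀ x, E x ≠ 0 → efac E q (x * q) N = efac E q x N * E (x * q ^ N) / E x :=
    fun x hx => by
      rw [← efac_succ, efac_succ']; field_simp
  have kk : E k * efac E q (k * q) N = efac E q k N * E (k * q ^ N) := by
    rw [← efac_succ', efac_succ]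
  have h3 := h.a_ne (N + 1) (by omega)
  have h4 := h.E_q (show N < _ by omega)
  have h6 := h.efac_q (show N ≤ _ by omega)
  have hb0 := h.b_ne 0 (by omega); rw [pow_zero, mul_one] at hb0
  have hc0 := h.c_ne 0 (by omega); rw [pow_zero, mul_one] at hc0
  have hd0 := h.d_ne 0 (by omega); rw [pow_zero, mul_one] at hd0
  have hb1 := h.efac_b (show N ≤ _ by omega)
  have hc1 := h.efac_c (show N ≤ _ by omega)
  have hd1 := h.efac_d (show N ≤ _ by omega)
  have hb2 := h.b_ne N (by omega)
  have hc2 := h.c_ne N (by omega)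
  have hd2 := h.d_ne N (by omega)
  have hadd := hE.add_sum ha hb hc hd hk (pow_ne_zero N hq) hq hbal
  rw [show a * q ^ N * q = a * q ^ (N + 1) by ring, show k * q ^ N / a = k / a * q ^ N by ring,
    show k * (q ^ N) ^ 2 * q = k * q ^ (2 * N + 1) by ring] at hadd
  have hmain : E (k * q ^ N) * E (k * b / a * q ^ N) * E (k * c / a * q ^ N) *
      E (k * d / a * q ^ N) / (E (q ^ (N + 1)) * E (a * q / b * q ^ N) * E (a * q / c * q ^ N) *
        E (a * q / d * q ^ N)) =
      E (k / a * q ^ N) * E (k * q ^ N) / (E (q ^ (N + 1)) * E (a * q ^ (N + 1))) +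
      q ^ N * (k / a) * E (k * q ^ (2 * N + 1)) * (E b * E c * E d) * E (k * q ^ N) /
        (E (q ^ (N + 1)) * E (a * q ^ (N + 1)) * (E (a * q / b * q ^ N) * E (a * q / c * q ^ N) *
          E (a * q / d * q ^ N))) := by
    rw [← sub_eq_zero]
    have : ∀ X Y Z W R S T U V A B C D D' : ℂ, A ≠ 0 → B ≠ 0 → C ≠ 0 → D ≠ 0 → D' ≠ 0 →
        D' * Y * (Z * W) - R * B * (C * D) = V →
        X * Y * Z * W / (A * B * C * D) = R * X / (A * D') + V * X / (A * D' * (B * C * D)) := by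
      intro X Y Z W R S T U V A B C D D' hA hB hC hD hD' hV
      rw [← hV]
      field_simp
      ring
    rw [sub_eq_zero]
    exact this _ _ _ _ _ 0 0 0 _ _ _ _ _ _ h4 hb2 hc2 hd2 h3 hadd
  rw [ftSum, ftSum, ftSum, e, e, e, e', e', e', key _ hb0, key _ hc0, key _ hd0, efac_succ,
    efac_succ, efac_succ, efac_succ, efac_succ, efac_succ, efac_succ, efac_succ, ← pow_succ']
  have hsplit : ∀ F₁ F₂ F₃ F₄ G₁ G₂ G₃ G₄ x₁ x₂ x₃ x₄ y₁ y₂ y₃ y₄ : ℂ,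
      F₁ * x₁ * (F₂ * x₂) * (F₃ * x₃) * (F₄ * x₄) / (G₁ * y₁ * (G₂ * y₂) * (G₃ * y₃) * (G₄ * y₄)) =
      F₁ * F₂ * F₃ * F₄ / (G₁ * G₂ * G₃ * G₄) * (x₁ * x₂ * x₃ * x₄ / (y₁ * y₂ * y₃ * y₄)) := by
    intros; rw [div_mul_div_comm]; ring
  rw [hsplit, hmain, mul_add]
  congr 1
  · ring
  · clear hsplit hmain hadd e e' key h
    generalize efac E q k N = w₁ at *
    generalize efac E q (k * q) N = w₂ at *
    generalize efac E q (k * b / a) N = w₃ at *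
    generalize efac E q (k * c / a) N = w₄ at *
    generalize efac E q (k * d / a) N = w₅ at *
    generalize efac E q q N = w₆ at *
    generalize efac E q (a * q / b) N = w₇ at *
    generalize efac E q (a * q / c) N = w₈ at *
    generalize efac E q (a * q / d) N = w₉ at *
    generalize E (a * q / b * q ^ N) = v₁ at *
    generalize E (a * q / c * q ^ N) = v₂ at *
    generalize E (a * q / d * q ^ N) = v₃ at *
    generalize E (a * q / b) = v₄ at *
    generalize E (a * q / c) = v₅ at *
    generalize E (a * q / d) = v₆ at *
    generalize E (q ^ (N + 1)) = v₇ at *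
    generalize E (a * q ^ (N + 1)) = v₈ at *
    generalize E (k * q ^ (2 * N + 1)) = v₉ at *
    generalize E (k * q ^ N) = u₁ at *
    generalize E k = u₂ at *
    rw [show w₁ * w₃ * w₄ * w₅ / (w₆ * w₇ * w₈ * w₉) * (q ^ N * (k / a) * v₉ * (E b * E c * E d) * u₁ /
      (v₇ * v₈ * (v₁ * v₂ * v₃))) = w₁ * u₁ * (w₃ * w₄ * w₅ / (w₆ * w₇ * w₈ * w₉) *
        (q ^ N * (k / a) * v₉ * (E b * E c * E d) / (v₇ * v₈ * (v₁ * v₂ * v₃)))) by ring, ← kk]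
    field_simp

/-- The last summand. -/
theorem ftTerm_last (hq : q ≠ 0) (ha : a ≠ 0) (hk : k ≠ 0) (N : ℕ)
    (h : FTNonzero E q a b c d (N + 1)) :
    ftTerm E q a b c d k (N + 1) (N + 1) =
      q ^ N * (k / a) * E (k * q ^ (2 * N + 1)) * (E b * E c * E d) * E k /
        (E (q ^ (N + 1)) * E (a * q ^ (N + 1)) *
          (E (a * q / b) * E (a * q / c) * E (a * q / d))) *
        ftTerm E q (a * q ^ 2) (b * q) (c * q) (d * q) (k * q) N N := by
  have e : ∀ x, a * q ^ 2 * q / (x * q) = a * q / x * q := fun x => by field_simp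
  have e' : ∀ x, x * q * q = x * q ^ 2 := fun x => by ring
  have h0 := h.a_ne 0 (by omega); rw [pow_zero, mul_one] at h0
  have h1 := h.a_ne 1 (by omega); rw [pow_one] at h1
  have h2 := h.a_ne 2 (by omega)
  have h3 := h.a_ne (N + 1) (by omega)
  have h4 := h.E_q (show N < _ by omega)
  have h7 := h.efac_q (show N ≤ _ by omega)
  have h8 := h.efac_a (show 2 * N + 2 ≤ _ by omega)
  have hb0 := h.b_ne 0 (by omega); rw [pow_zero, mul_one] at hb0
  have hc0 := h.c_ne 0 (by omega); rw [pow_zero, mul_one] at hc0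
  have hd0 := h.d_ne 0 (by omega); rw [pow_zero, mul_one] at hd0
  have hb1 := h.efac_b (show N + 1 ≤ _ by omega)
  have hc1 := h.efac_c (show N + 1 ≤ _ by omega)
  have hd1 := h.efac_d (show N + 1 ≤ _ by omega)
  have kx : ∀ x, efac E q x (N + 1) = E x * efac E q (x * q) N := fun x => efac_succ' _ _
  rw [kx] at hb1 hc1 hd1
  replace hb1 := right_ne_zero_of_mul hb1
  replace hc1 := right_ne_zero_of_mul hc1
  replace hd1 := right_ne_zero_of_mul hd1
  have ka : efac E q a (N + 1) = E a * E (a * q) * efac E q (a * q ^ 2) N /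
      E (a * q ^ (N + 1)) := by
    rw [eq_div_iff h3, ← efac_succ, efac_succ', efac_succ', e', mul_assoc]
  have kk : efac E q k (2 * N + 2) =
      E k * efac E q (k * q) (2 * N) * E (k * q ^ (2 * N + 1)) := by
    rw [efac_succ, efac_succ']
  have kaq : efac E q (a * q) (2 * N + 2) =
      E (a * q) * E (a * q ^ 2) * efac E q (a * q ^ 2 * q) (2 * N) := by
    rw [efac_succ', efac_succ', e', ← mul_assoc (E _) (E _)]
  rw [kaq] at h8
  replace h8 := right_ne_zero_of_mul h8
  rw [ftTerm, ftTerm, wpKernel, wpKernel, Nat.sub_self, Nat.sub_self, ← two_mul, ← two_mul,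
    show 2 * (N + 1) = 2 * N + 2 by ring, e, e, e, kk, kaq, ka, kx (a * q / b), kx (a * q / c),
    kx (a * q / d), kx b, kx c, kx d, efac_succ q N, ← pow_succ',
    show a * q ^ 2 * q ^ (2 * N) = a * q ^ (2 * N + 2) by ring,
    show k * q / (a * q ^ 2) = k / a / q by field_simp, div_pow (k / a) q N, pow_succ (k / a) N]
  simp only [efac_zero]
  clear kaq ka kx kk e e' h
  generalize efac E q (k * q) (2 * N) = w₂ at *
  generalize efac E q q N = w₃ at *
  generalize efac E q (a * q ^ 2 * q) (2 * N) = w₄ at *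
  generalize efac E q (a * q ^ 2) N = w₅ at *
  generalize efac E q (b * q) N = w₆ at *
  generalize efac E q (c * q) N = w₇ at *
  generalize efac E q (d * q) N = w₈ at *
  generalize efac E q (a * q / b * q) N = v₁ at *
  generalize efac E q (a * q / c * q) N = v₂ at *
  generalize efac E q (a * q / d * q) N = v₃ at *
  generalize E (a * q / b) = v₄ at *
  generalize E (a * q / c) = v₅ at *
  generalize E (a * q / d) = v₆ at *
  generalize E (q ^ (N + 1)) = v₈ at *
  generalize E (a * q ^ (N + 1)) = u₂ at *
  generalize E (a * q ^ (2 * N + 2)) = u₃ at *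
  generalize E (a * q ^ 2) = u₄ at *
  generalize E (k * q ^ (2 * N + 1)) = v₇ at *
  generalize E (a * q) = u₅ at *
  generalize E a = u₆ at *
  generalize E b = u₇ at *
  generalize E c = u₈ at *
  generalize E d = u₉ at *
  generalize E k = u₁₀ at *
  have hqi := pow_ne_zero N hq
  have hki := pow_ne_zero N (div_ne_zero hk ha)
  generalize (k / a) ^ N = t₁ at *
  generalize q ^ N = t₂ at *
  simp only [mul_div_assoc', div_mul_eq_mul_div, div_div, one_mul]
  rw [div_eq_div_iff (by positivity) (by positivity)]
  ring

/-- The contiguous relation for the summands. -/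
theorem ftTerm_succ_succ (hE : IsTheta E) (hq : q ≠ 0) (ha : a ≠ 0) (hk : k ≠ 0) (M i : ℕ)
    (h : FTNonzero E q a b c d (M + 1 + i + 1)) :
    ftTerm E q a b c d k (M + 1 + i + 1) (i + 1) =
      E (k / a * q ^ (M + 1 + i)) * E (k * q ^ (M + 1 + i)) /
        (E (q ^ (M + 1 + i + 1)) * E (a * q ^ (M + 1 + i + 1))) *
        ftTerm E q a b c d k (M + 1 + i) (i + 1) +
      q ^ (M + 1 + i) * (k / a) * E (k * q ^ (2 * (M + 1 + i) + 1)) * (E b * E c * E d) * E k /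
        (E (q ^ (M + 1 + i + 1)) * E (a * q ^ (M + 1 + i + 1)) *
          (E (a * q / b) * E (a * q / c) * E (a * q / d))) *
        ftTerm E q (a * q ^ 2) (b * q) (c * q) (d * q) (k * q) (M + 1 + i) i := by
  have h' : FTNonzero E q a b c d (M + (i + 1) + 1) := by
    rwa [show M + (i + 1) + 1 = M + 1 + i + 1 by ring]
  have h'' : FTNonzero E q a b c d (M + i + 2) := by
    rwa [show M + i + 2 = M + 1 + i + 1 by ring]
  have t1 := ftTerm_succ_left (k := k) M (i + 1) h'
  have t2 := ftTerm_shift hq ha hk M i h''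
  have t3 := hE.add_term ha hk (pow_ne_zero (M + 1 + i) hq) (pow_ne_zero (i + 1) hq) hq
  rw [show k * q ^ (M + 1 + i) / (a * q ^ (i + 1)) = k / a * q ^ M by
      field_simp; ring,
    show k * q ^ (M + 1 + i) * q ^ (i + 1) = k * q ^ (M + 2 * (i + 1)) by ring,
    show q ^ (M + 1 + i) * q = q ^ (M + 1 + i + 1) by ring,
    show a * q ^ (M + 1 + i) * q = a * q ^ (M + 1 + i + 1) by ring,
    show k * q ^ (M + 1 + i) / a = k / a * q ^ (M + 1 + i) by ring,
    show q ^ (M + 1 + i + 1) / q ^ (i + 1) = q ^ (M + 1) by field_simp; ring,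
    show a * q ^ (M + 1 + i + 1) * q ^ (i + 1) = a * q ^ (M + 2 * i + 3) by ring,
    show k * (q ^ (M + 1 + i)) ^ 2 * q = k * q ^ (2 * (M + 1 + i) + 1) by ring] at t3
  rw [show M + (i + 1) + 1 = M + 1 + i + 1 by ring, show M + (i + 1) = M + 1 + i by ring,
    show M + 2 * (i + 1) + 1 = M + 2 * i + 3 by ring] at t1
  rw [show M + (i + 1) = M + 1 + i by ring] at t2
  rw [t1]
  have h3 := h.a_ne (M + 2 * i + 3) (by omega)
  have h4 := h.E_q (show M < _ by omega)
  have h5 := h.a_ne (M + 1 + i + 1) (by omega)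
  have h6 := h.E_q (show M + 1 + i < _ by omega)
  have hb0 := h.b_ne 0 (by omega); rw [pow_zero, mul_one] at hb0
  have hc0 := h.c_ne 0 (by omega); rw [pow_zero, mul_one] at hc0
  have hd0 := h.d_ne 0 (by omega); rw [pow_zero, mul_one] at hd0
  have hqi := pow_ne_zero i hq
  have hqM := pow_ne_zero M hq
  rw [show ∀ x y z D₁ D₂ D₃ T : ℂ, x * y * z * (E b * E c * E d) * E k / (D₁ * D₂ * D₃) * T =
    x * y * z / (D₁ * D₂ * D₃) * (E k * E b * E c * E d * T) by intros; ring, t2]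
  generalize ftTerm E q a b c d k (M + 1 + i) (i + 1) = T
  have hmain : E (k / a * q ^ M) * E (k * q ^ (M + 2 * (i + 1))) /
      (E (q ^ (M + 1)) * E (a * q ^ (M + 2 * i + 3))) =
    E (k / a * q ^ (M + 1 + i)) * E (k * q ^ (M + 1 + i)) /
      (E (q ^ (M + 1 + i + 1)) * E (a * q ^ (M + 1 + i + 1))) +
    q ^ (M + 1) * (E (k * q ^ (2 * (M + 1 + i) + 1)) * E (k / (a * q))) *
      (E (a * q ^ (i + 1)) * E (q ^ (i + 1))) /
      (E (q ^ (M + 1)) * E (a * q ^ (M + 2 * i + 3)) *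
        (E (q ^ (M + 1 + i + 1)) * E (a * q ^ (M + 1 + i + 1)))) := by
    rw [← t3]
    clear t1 t2 t3 h h' h''
    field_simp
    ring
  rw [hmain]
  clear t1 t2 t3 h h' h'' hmain
  rw [mul_add]
  congr 1
  · ring
  · generalize E (a * q / b) = v₄ at *
    generalize E (a * q / c) = v₅ at *
    generalize E (a * q / d) = v₆ at *
    generalize E (k / (a * q)) = v₇ at *
    generalize E (q ^ (M + 1)) = v₈ at *
    generalize E (q ^ (i + 1)) = v₉ at *
    generalize E (a * q ^ (M + 2 * i + 3)) = u₁ at *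
    generalize E (a * q ^ (i + 1)) = u₂ at *
    generalize E (q ^ (M + 1 + i + 1)) = u₃ at *
    generalize E (a * q ^ (M + 1 + i + 1)) = u₄ at *
    rw [pow_add q (M + 1) i]
    simp only [mul_div_assoc', div_mul_eq_mul_div, div_div]
    rw [div_eq_div_iff (by positivity) (by positivity)]
    ring

/-- The Frenkel–Turaev sum. -/
theorem frenkel_turaev (hE : IsTheta E) (hq : q ≠ 0) (n : ℕ) : ∀ {a b c d k : ℂ}, a ≠ 0 →
    b ≠ 0 → c ≠ 0 → d ≠ 0 → k ≠ 0 → b * c * d * k = a ^ 2 * q → FTNonzero E q a b c d n →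
    ∑ j ∈ Finset.range (n + 1), ftTerm E q a b c d k n j = ftSum E q a b c d k n := by
  induction n with
  | zero =>
    intro a b c d k ha hb hc hd hk hbal h
    have h0 := h.a_ne 0 (by omega); rw [pow_zero, mul_one] at h0
    simp [ftTerm, wpKernel, ftSum, efac_zero, h0]
  | succ N ih =>
    intro a b c d k ha hb hc hd hk hbal h
    rw [ftSum_succ hE hq ha hb hc hd hk hbal N h, ← ih ha hb hc hd hk hbal h.pred,
      ← ih (by positivity) (by positivity) (by positivity) (by positivity) (by positivity)
        (by linear_combination q ^ 4 * hbal) (h.shift hq)]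
    rw [Finset.sum_range_succ', Finset.sum_range_succ _ N, ftTerm_last hq ha hk N h,
      Finset.sum_range_succ' (fun j => ftTerm E q a b c d k N j) N,
      Finset.sum_range_succ (fun j => ftTerm E q (a * q ^ 2) (b * q) (c * q) (d * q) (k * q) N j) N]
    have hz := ftTerm_succ_left (k := k) N 0 h
    rw [mul_zero] at hz
    simp only [add_zero] at hz
    rw [hz]
    have hmid : ∀ i ∈ Finset.range N, ftTerm E q a b c d k (N + 1) (i + 1) =
        E (k / a * q ^ N) * E (k * q ^ N) / (E (q ^ (N + 1)) * E (a * q ^ (N + 1))) *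
          ftTerm E q a b c d k N (i + 1) +
        q ^ N * (k / a) * E (k * q ^ (2 * N + 1)) * (E b * E c * E d) * E k /
          (E (q ^ (N + 1)) * E (a * q ^ (N + 1)) *
            (E (a * q / b) * E (a * q / c) * E (a * q / d))) *
          ftTerm E q (a * q ^ 2) (b * q) (c * q) (d * q) (k * q) N i := fun i hi => by
      obtain ⟨M, rfl⟩ := Nat.exists_eq_add_of_lt (Finset.mem_range.1 hi)
      have := ftTerm_succ_succ hE hq ha hk M i (by rwa [show M + 1 + i = i + M + 1 by ring])
      rw [show M + 1 + i = i + M + 1 by ring] at this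
      exact this
    rw [Finset.sum_congr rfl hmid, Finset.sum_add_distrib, ← Finset.mul_sum, ← Finset.mul_sum]
    ring

end FrenkelTuraev

section Transformation

variable {E : ℂ → ℂ}

theorem sum_range_sum_range_succ {M : Type*} [AddCommMonoid M] (n : ℕ) (h : ℕ → ℕ → M) :
    ∑ k ∈ Finset.range (n + 1), ∑ j ∈ Finset.range (k + 1), h k j =
      ∑ j ∈ Finset.range (n + 1), ∑ i ∈ Finset.range (n - j + 1), h (j + i) j := by
  rw [Finset.sum_comm' (s' := fun j => Finset.Ico j (n + 1)) (t' := Finset.range (n + 1))]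
  · refine Finset.sum_congr rfl fun j hj => ?_
    have := Finset.mem_range.1 hj
    rw [Finset.sum_Ico_eq_sum_range, show n + 1 - j = n - j + 1 by omega]
  · intro x y
    simp only [Finset.mem_range, Finset.mem_Ico]
    omega

/-- The summand of a terminating very-well-poised series, in kernel form. -/
noncomputable def tenTerm (E : ℂ → ℂ) (q a b c d f g k : ℂ) (n j : ℕ) : ℂ :=
  wpKernel E q a k n j * (E (a * q ^ (2 * j)) / E a *
    (efac E q a j * efac E q b j * efac E q c j * efac E q d j * efac E q f j * efac E q g j /
      (efac E q q j * efac E q (a * q / b) j * efac E q (a * q / c) j * efac E q (a * q / d) j *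
        efac E q (a * q / f) j * efac E q (a * q / g) j)) * (k / a) ^ j)

variable {q a b c d f g k l : ℂ}

theorem FTNonzero.mono {m n : ℕ} (hmn : m ≤ n) (h : FTNonzero E q a b c d n) :
    FTNonzero E q a b c d m :=
  ⟨fun i hi => h.q_ne i (by omega), fun i hi => h.a_ne i (by omega),
    fun i hi => h.b_ne i (by omega), fun i hi => h.c_ne i (by omega),
    fun i hi => h.d_ne i (by omega)⟩

theorem wpKernel_add (hq : q ≠ 0) (j i m : ℕ) :
    wpKernel E q a k (j + m) (j + i) = efac E q k (2 * j) / efac E q (a * q) (2 * j) *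
      wpKernel E q (a * q ^ (2 * j)) (k * q ^ (2 * j)) m i := by
  rw [wpKernel, wpKernel, show j + m - (j + i) = m - i by omega,
    show j + m + (j + i) = 2 * j + (m + i) by ring, efac_add k, efac_add (a * q),
    show k * q ^ (2 * j) / (a * q ^ (2 * j)) = k / a by field_simp,
    show a * q ^ (2 * j) * q = a * q * q ^ (2 * j) by ring]
  ring

theorem eq_of_eq_mul_inv_mul {x y L R : ℂ} (hx : x ≠ 0) (hy : y ≠ 0)
    (h : L = x * x⁻¹ * (y * y⁻¹) * R) : L = R := by
  rw [h, mul_inv_cancel₀ hx, mul_inv_cancel₀ hy, one_mul, one_mul]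

/-- The summand of the double sum behind the transformation of very-well-poised series. -/
theorem tenTerm_double (hq : q ≠ 0) (ha : a ≠ 0) (hl : l ≠ 0) (hf : f ≠ 0) (hg : g ≠ 0)
    (j i m : ℕ) (hEa : E a ≠ 0) (hEa' : E (a * q ^ (2 * j)) ≠ 0)
    (haq : efac E q (a * q) (2 * j) ≠ 0) (W : ℂ) :
    wpKernel E q a k (j + m) (j + i) * (E (a * q ^ (2 * (j + i))) / E a) *
      (efac E q f (j + i) * efac E q g (j + i) /
        (efac E q (a * q / f) (j + i) * efac E q (a * q / g) (j + i))) * (k / a) ^ (j + i) *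
      (wpKernel E q l a (j + i) j * W) =
    efac E q k (2 * j) / efac E q (l * q) (2 * j) * (k / a) ^ j *
      (efac E q f j * efac E q g j / (efac E q (a * q / f) j * efac E q (a * q / g) j)) * W *
      ftTerm E q (a * q ^ (2 * j)) (a / l) (f * q ^ j) (g * q ^ j) (k * q ^ (2 * j)) m i := by
  have h1 : efac E q a (2 * j) = E a * efac E q (a * q) (2 * j) / E (a * q ^ (2 * j)) := by
    rw [eq_div_iff hEa', ← efac_succ, efac_succ']
  have e : ∀ x, x ≠ 0 → a * q ^ (2 * j) * q / (x * q ^ j) = a * q / x * q ^ j := fun x hx => by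
    rw [two_mul, pow_add]; field_simp
  have hw : wpKernel E q l a (j + i) j = efac E q (a / l) i * (efac E q a (2 * j) *
      efac E q (a * q ^ (2 * j)) i) / (efac E q q i * (efac E q (l * q) (2 * j) *
        efac E q (l * q * q ^ (2 * j)) i)) := by
    rw [wpKernel, show j + i - j = i by omega, show j + i + j = 2 * j + i by ring, efac_add a,
      efac_add (l * q)]
  rw [wpKernel_add hq, ftTerm, hw, efac_add f, efac_add g, efac_add (a * q / f),
    efac_add (a * q / g), e f hf, e g hg,
    show a * q ^ (2 * j) * q / (a / l) = l * q * q ^ (2 * j) by field_simp,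
    show k * q ^ (2 * j) / (a * q ^ (2 * j)) = k / a by field_simp,
    show a * q ^ (2 * j) * q ^ (2 * i) = a * q ^ (2 * (j + i)) by ring, pow_add (k / a) j i, h1]
  generalize wpKernel E q (a * q ^ (2 * j)) (k * q ^ (2 * j)) m i = w at *
  generalize efac E q (a * q) (2 * j) = x₁ at *
  generalize E (a * q ^ (2 * j)) = x₂ at *
  generalize E a = x₃ at *
  refine eq_of_eq_mul_inv_mul haq hEa ?_
  ring

/-- The nonvanishing of the denominators in `tenTerm_transform`. -/
structure TenNonzero (E : ℂ → ℂ) (q a b c d f g l : ℂ) (n : ℕ) : Prop where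
  q_ne : ∀ m < n, E (q * q ^ m) ≠ 0
  a_ne : ∀ m ≤ 2 * n, E (a * q ^ m) ≠ 0
  l_ne : ∀ m ≤ 2 * n, E (l * q ^ m) ≠ 0
  b_ne : ∀ m < n, E (a * q / b * q ^ m) ≠ 0
  c_ne : ∀ m < n, E (a * q / c * q ^ m) ≠ 0
  d_ne : ∀ m < n, E (a * q / d * q ^ m) ≠ 0
  f_ne : ∀ m < n, E (a * q / f * q ^ m) ≠ 0
  g_ne : ∀ m < n, E (a * q / g * q ^ m) ≠ 0
  f_ne' : ∀ m < n, E (l * q / f * q ^ m) ≠ 0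
  g_ne' : ∀ m < n, E (l * q / g * q ^ m) ≠ 0

/-- The transformation formula for terminating very-well-poised series, in kernel form. -/
theorem tenTerm_transform (hE : IsTheta E) (hq : q ≠ 0) (ha : a ≠ 0) (hb : b ≠ 0) (hc : c ≠ 0)
    (hd : d ≠ 0) (hf : f ≠ 0) (hg : g ≠ 0) (hl : l * (b * c * d) = a ^ 2 * q)
    (hk : k * (f * g) = l * a * q) (n : ℕ) (h : TenNonzero E q a b c d f g l n) :
    ∑ j ∈ Finset.range (n + 1), tenTerm E q a b c d f g k n j =
      efac E q (l * q / f) n * efac E q (l * q / g) n /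
        (efac E q (a * q / f) n * efac E q (a * q / g) n) *
      ∑ j ∈ Finset.range (n + 1),
        tenTerm E q l (l * b / a) (l * c / a) (l * d / a) f g k n j := by
  have hl0 : l ≠ 0 := left_ne_zero_of_mul (a := l) (b := b * c * d) (by rw [hl]; positivity)
  have hk0 : k ≠ 0 := left_ne_zero_of_mul (a := k) (b := f * g) (by rw [hk]; positivity)
  have e : ∀ x, x ≠ 0 → l * q / (l * x / a) = a * q / x := fun x hx => by field_simp
  have eb : a * (l * b / a) / l = b := by field_simp
  have ec : a * (l * c / a) / l = c := by field_simp
  have ed : a * (l * d / a) / l = d := by field_simp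
  have hEa : E a ≠ 0 := by simpa using h.a_ne 0 (by omega)
  have hft : FTNonzero E q l (l * b / a) (l * c / a) (l * d / a) n :=
    ⟨h.q_ne, h.l_ne, by rw [e b hb]; exact h.b_ne, by rw [e c hc]; exact h.c_ne,
      by rw [e d hd]; exact h.d_ne⟩
  set W : ℕ → ℂ := fun j => E (l * q ^ (2 * j)) / E l *
    (efac E q l j * efac E q (l * b / a) j * efac E q (l * c / a) j * efac E q (l * d / a) j /
      (efac E q q j * efac E q (a * q / b) j * efac E q (a * q / c) j * efac E q (a * q / d) j)) *
    (a / l) ^ j with hW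
  have step1 : ∀ i ∈ Finset.range (n + 1), tenTerm E q a b c d f g k n i =
      ∑ j ∈ Finset.range (i + 1), wpKernel E q a k n i * (E (a * q ^ (2 * i)) / E a) *
      (efac E q f i * efac E q g i / (efac E q (a * q / f) i * efac E q (a * q / g) i)) *
        (k / a) ^ i * (wpKernel E q l a i j * W j) := by
    intro i hi
    have hft' := frenkel_turaev hE hq i hl0 (show l * b / a ≠ 0 by positivity)
      (show l * c / a ≠ 0 by positivity) (show l * d / a ≠ 0 by positivity) ha
      (by field_simp; linear_combination hl) (hft.mono (by simpa using hi))
    have hterm : ∀ j, ftTerm E q l (l * b / a) (l * c / a) (l * d / a) a i j =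
        wpKernel E q l a i j * W j := fun j => by
      rw [ftTerm, e b hb, e c hc, e d hd]
    rw [← Finset.mul_sum, ← Finset.sum_congr rfl fun j _ => hterm j, hft', ftSum, e b hb, e c hc,
      e d hd, eb, ec, ed, tenTerm]
    simp only [div_eq_mul_inv, mul_inv]
    ring
  rw [Finset.sum_congr rfl step1, sum_range_sum_range_succ, Finset.mul_sum]
  refine Finset.sum_congr rfl fun j hj => ?_
  obtain ⟨m, rfl⟩ := Nat.exists_eq_add_of_le (show j ≤ n by simpa [Nat.lt_succ_iff] using hj)
  rw [show j + m - j = m by omega]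
  have haq : efac E q (a * q) (2 * j) ≠ 0 := efac_ne_zero fun i hi => by
    rw [mul_assoc, ← pow_succ']; exact h.a_ne _ (by omega)
  have e' : ∀ x, x ≠ 0 → a * q ^ (2 * j) * q / (x * q ^ j) = a * q / x * q ^ j := fun x hx => by
    rw [two_mul, pow_add]; field_simp
  have el : a * q ^ (2 * j) * q / (a / l) = l * q * q ^ (2 * j) := by field_simp
  have hft2 : FTNonzero E q (a * q ^ (2 * j)) (a / l) (f * q ^ j) (g * q ^ j) m := by
    refine ⟨fun i hi => h.q_ne i (by omega), fun i hi => ?_, fun i hi => ?_, fun i hi => ?_,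
      fun i hi => ?_⟩
    · rw [mul_assoc, ← pow_add]; exact h.a_ne _ (by omega)
    · rw [el, mul_assoc l, ← pow_succ', mul_assoc, ← pow_add]; exact h.l_ne _ (by omega)
    · rw [e' f hf, mul_assoc, ← pow_add]; exact h.f_ne _ (by omega)
    · rw [e' g hg, mul_assoc, ← pow_add]; exact h.g_ne _ (by omega)
  rw [Finset.sum_congr rfl fun i _ => tenTerm_double hq ha hl0 hf hg j i m hEa
    (h.a_ne _ (by omega)) haq (W j), ← Finset.mul_sum,
    frenkel_turaev hE hq m (by positivity) (by positivity) (by positivity) (by positivity)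
      (by positivity) (by field_simp; linear_combination q ^ (2 * j) * hk) hft2]
  have hf0 : efac E q (l * q / f) j ≠ 0 := efac_ne_zero fun i hi => h.f_ne' _ (by omega)
  have hg0 : efac E q (l * q / g) j ≠ 0 := efac_ne_zero fun i hi => h.g_ne' _ (by omega)
  rw [ftSum, tenTerm, wpKernel, show j + m - j = m by omega, show j + m + j = 2 * j + m by ring,
    e' f hf, e' g hg, el, e b hb, e c hc, e d hd, hW, efac_add k, efac_add (l * q),
    efac_add (l * q / f), efac_add (l * q / g), efac_add (a * q / f), efac_add (a * q / g),
    show k * q ^ (2 * j) * (a / l) / (a * q ^ (2 * j)) = k / l by field_simp,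
    show k * q ^ (2 * j) * (f * q ^ j) / (a * q ^ (2 * j)) = l * q / g * q ^ j by
      field_simp; linear_combination hk,
    show k * q ^ (2 * j) * (g * q ^ j) / (a * q ^ (2 * j)) = l * q / f * q ^ j by
      field_simp; linear_combination hk,
    show k / l = k / a * (a / l) by field_simp, mul_pow]
  refine (eq_of_eq_mul_inv_mul hf0 hg0 ?_).symm
  ring

end Transformation

section StandardForm

variable {E : ℂ → ℂ} {q a b c d f g h k l : ℂ}

theorem efac_flip (hE : IsTheta E) (hq : q ≠ 0) {x : ℂ} (hx : x ≠ 0) {n j : ℕ} (hj : j ≤ n) :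
    efac E q (q / (x * q ^ n)) j * efac E q x (n - j) * (x * q ^ n) ^ j =
      (-1) ^ j * q ^ ((j + 1).choose 2) * efac E q x n := by
  induction j with
  | zero => simp [efac_zero]
  | succ j ih =>
    obtain ⟨m, rfl⟩ := Nat.exists_eq_add_of_le hj
    have ih := ih (by omega)
    rw [show j + 1 + m - j = m + 1 by omega, efac_succ x m] at ih
    rw [show j + 1 + m - (j + 1) = m by omega, efac_succ _ j, Nat.choose_succ_succ' (j + 1) 1,
      Nat.choose_one_right, pow_add q (j + 1) ((j + 1).choose (1 + 1)),
      show q / (x * q ^ (j + 1 + m)) * q ^ j = q ^ (j + 1) / (x * q ^ (j + 1 + m)) by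
        rw [pow_succ q j]; ring,
      hE.inv_div (pow_ne_zero _ hq) (mul_ne_zero hx (pow_ne_zero _ hq)),
      show x * q ^ (j + 1 + m) / q ^ (j + 1) = x * q ^ m by
        rw [pow_add q (j + 1) m]; field_simp,
      pow_succ (x * q ^ (j + 1 + m)) j]
    have h1 : x * q ^ (j + 1 + m) ≠ 0 := mul_ne_zero hx (pow_ne_zero _ hq)
    generalize x * q ^ (j + 1 + m) = y at *
    field_simp
    linear_combination -ih

/-- The summand of a terminating very-well-poised series. -/
noncomputable def stdTerm (E : ℂ → ℂ) (q a b c d f g h z : ℂ) (j : ℕ) : ℂ :=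
  E (a * q ^ (2 * j)) / E a *
    (efac E q a j * efac E q b j * efac E q c j * efac E q d j * efac E q f j * efac E q g j *
        efac E q h j * efac E q z j * q ^ j /
      (efac E q q j * efac E q (a * q / b) j * efac E q (a * q / c) j * efac E q (a * q / d) j *
        efac E q (a * q / f) j * efac E q (a * q / g) j * efac E q (a * q / h) j *
        efac E q (a * q / z) j))

theorem stdTerm_eq (hE : IsTheta E) (hq : q ≠ 0) (ha : a ≠ 0) (hk : k ≠ 0) {n j : ℕ} (hj : j ≤ n)
    (hqn : efac E q q n ≠ 0) (hkn : efac E q (k / a) n ≠ 0) :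
    wpKernel E q a k n 0 * stdTerm E q a b c d f g (k * q ^ n) (q ^ n)⁻¹ j =
      tenTerm E q a b c d f g k n j := by
  have f1 := efac_flip hE hq hq hj
  have f2 := efac_flip hE hq (div_ne_zero hk ha) hj
  have hqj : efac E q q (n - j) ≠ 0 := by
    obtain ⟨i, rfl⟩ := Nat.exists_eq_add_of_le' hj
    rw [efac_add] at hqn
    rw [Nat.add_sub_cancel]
    exact left_ne_zero_of_mul hqn
  have hkj : efac E q (k / a) (n - j) ≠ 0 := by
    obtain ⟨i, rfl⟩ := Nat.exists_eq_add_of_le' hj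
    rw [efac_add] at hkn
    rw [Nat.add_sub_cancel]
    exact left_ne_zero_of_mul hkn
  have hs : (-1) ^ j * q ^ ((j + 1).choose 2) ≠ 0 := by simp [hq]
  have e1 : q / (q * q ^ n) = (q ^ n)⁻¹ := by field_simp
  have e2 : q / (k / a * q ^ n) = a * q / (k * q ^ n) := by field_simp
  rw [e1] at f1
  rw [e2] at f2
  rw [stdTerm, tenTerm, wpKernel, wpKernel, efac_add k n j, efac_add (a * q) n j, Nat.sub_zero,
    add_zero, show a * q / (q ^ n)⁻¹ = a * q * q ^ n by field_simp]
  have hx1 : q * q ^ n ≠ 0 := by positivity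
  have hx2 : k / a * q ^ n ≠ 0 := by positivity
  have f1' : efac E q (q ^ n)⁻¹ j = (-1) ^ j * q ^ ((j + 1).choose 2) * efac E q q n /
      (efac E q q (n - j) * (q * q ^ n) ^ j) := by
    rw [eq_div_iff (by positivity), ← f1]; ring
  have f2' : efac E q (a * q / (k * q ^ n)) j =
      (-1) ^ j * q ^ ((j + 1).choose 2) * efac E q (k / a) n /
      (efac E q (k / a) (n - j) * (k / a * q ^ n) ^ j) := by
    rw [eq_div_iff (by positivity), ← f2]; ring
  have hmain : efac E q (q ^ n)⁻¹ j * q ^ j * efac E q (k / a) n / (efac E q (a * q / (k * q ^ n)) j *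
      efac E q q n) = efac E q (k / a) (n - j) / efac E q q (n - j) * (k / a) ^ j := by
    rw [f1', f2', mul_pow, mul_pow]
    clear f1 f1' f2 f2'
    generalize (-1) ^ j * q ^ ((j + 1).choose 2) = s at *
    have : k / a ≠ 0 := by positivity
    generalize k / a = t at *
    field_simp
  rw [mul_div_assoc (efac E q (k / a) (n - j)), ← mul_div_assoc]
  calc _ = efac E q (q ^ n)⁻¹ j * q ^ j * efac E q (k / a) n / (efac E q (a * q / (k * q ^ n)) j *
      efac E q q n) * (efac E q k n * efac E q (k * q ^ n) j /
        (efac E q (a * q) n * efac E q (a * q * q ^ n) j) * (E (a * q ^ (2 * j)) / E a *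
    (efac E q a j * efac E q b j * efac E q c j * efac E q d j * efac E q f j * efac E q g j /
      (efac E q q j * efac E q (a * q / b) j * efac E q (a * q / c) j * efac E q (a * q / d) j *
        efac E q (a * q / f) j * efac E q (a * q / g) j)))) := by
        ring
    _ = _ := by rw [hmain]; ring

/-- The transformation formula for terminating very-well-poised series. -/
theorem stdTerm_transform (hE : IsTheta E) (hq : q ≠ 0) (ha : a ≠ 0) (hb : b ≠ 0) (hc : c ≠ 0)
    (hd : d ≠ 0) (hf : f ≠ 0) (hg : g ≠ 0) (hl : l * (b * c * d) = a ^ 2 * q) (n : ℕ)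
    (hk : h * (f * g) = l * a * q * q ^ n) (hn : TenNonzero E q a b c d f g l n)
    (hh : efac E q (h / q ^ n) n ≠ 0) (haf : efac E q (a * q / (f * g)) n ≠ 0)
    (hlf : efac E q (l * q / (f * g)) n ≠ 0) :
    ∑ j ∈ Finset.range (n + 1), stdTerm E q a b c d f g h (q ^ n)⁻¹ j =
      efac E q (a * q) n * efac E q (a * q / (f * g)) n * efac E q (l * q / f) n *
          efac E q (l * q / g) n /
        (efac E q (l * q) n * efac E q (l * q / (f * g)) n * efac E q (a * q / f) n *
          efac E q (a * q / g) n) *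
      ∑ j ∈ Finset.range (n + 1),
        stdTerm E q l (l * b / a) (l * c / a) (l * d / a) f g h (q ^ n)⁻¹ j := by
  have hl0 : l ≠ 0 := left_ne_zero_of_mul (a := l) (b := b * c * d) (by rw [hl]; positivity)
  obtain ⟨k, rfl⟩ : ∃ k, h = k * q ^ n := ⟨h / q ^ n, by field_simp⟩
  replace hk : k * (f * g) = l * a * q := by
    apply mul_right_cancel₀ (pow_ne_zero n hq); linear_combination hk
  have hk0 : k ≠ 0 := left_ne_zero_of_mul (a := k) (b := f * g) (by rw [hk]; positivity)
  rw [show k * q ^ n / q ^ n = k by field_simp] at hh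
  have e1 : a * q / (f * g) = k / l := by field_simp; linear_combination -hk
  have e2 : l * q / (f * g) = k / a := by field_simp; linear_combination -hk
  rw [e1] at haf
  rw [e2] at hlf
  have hqn : efac E q q n ≠ 0 := efac_ne_zero hn.q_ne
  have haq : efac E q (a * q) n ≠ 0 := efac_ne_zero fun i hi => by
    rw [mul_assoc, ← pow_succ']; exact hn.a_ne _ (by omega)
  have hlq : efac E q (l * q) n ≠ 0 := efac_ne_zero fun i hi => by
    rw [mul_assoc, ← pow_succ']; exact hn.l_ne _ (by omega)
  have ht := tenTerm_transform hE hq ha hb hc hd hf hg hl hk n hn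
  rw [Finset.sum_congr rfl fun j hj => (stdTerm_eq hE hq ha hk0
      (show j ≤ n by simpa [Nat.lt_succ_iff] using hj) hqn hlf).symm,
    Finset.sum_congr rfl fun j hj => (stdTerm_eq (a := l) hE hq hl0 hk0
      (show j ≤ n by simpa [Nat.lt_succ_iff] using hj) hqn haf).symm,
    ← Finset.mul_sum, ← Finset.mul_sum, wpKernel, wpKernel, Nat.sub_zero, add_zero] at ht
  rw [e1, e2]
  have hw : efac E q (k / a) n * efac E q k n / (efac E q q n * efac E q (a * q) n) ≠ 0 := by
    positivity
  apply mul_left_cancel₀ hw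
  rw [ht]
  generalize Finset.sum (Finset.range (n + 1)) (fun j => stdTerm E q l (l * b / a) (l * c / a)
    (l * d / a) f g (k * q ^ n) (q ^ n)⁻¹ j) = S
  clear ht hw
  refine (eq_of_eq_mul_inv_mul haq hlf ?_).symm
  ring

end StandardForm

section Cubic

variable {E : ℂ → ℂ} {q a b c d : ℂ}

theorem efac_three_mul (x : ℂ) (n : ℕ) :
    efac E q x (3 * n) = efac E (q ^ 3) x n * efac E (q ^ 3) (x * q) n *
      efac E (q ^ 3) (x * q ^ 2) n := by
  induction n with
  | zero => simp [efac_zero]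
  | succ n ih =>
    rw [show 3 * (n + 1) = 3 * n + 1 + 1 + 1 by ring, efac_succ, efac_succ, efac_succ, ih,
      efac_succ, efac_succ, efac_succ, show x * q * (q ^ 3) ^ n = x * q ^ (3 * n + 1) by ring,
      show x * q ^ 2 * (q ^ 3) ^ n = x * q ^ (3 * n + 1 + 1) by ring, ← pow_mul]
    ring

theorem IsTheta.add_cubic (hE : IsTheta E) {J u : ℂ} (hq : q ≠ 0) (ha : a ≠ 0) (hb : b ≠ 0)
    (hc : c ≠ 0) (hd : d ≠ 0) (hJ : J ≠ 0) (hu : u ≠ 0) (hbal : b * c * d = a * q) :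
    E (d / q * (J / u)) * E (a * (J * u)) * (E (a / b * u ^ 3) * E (a / c * u ^ 3)) -
      d * u ^ 2 / q * (E (a * d / q * (J * u ^ 3)) * E (J / u ^ 3)) * (E (b * u) * E (c * u)) =
    E (a * u ^ 4) * E (d / q * u ^ 2) * (E (a / b * J) * E (a / c * J)) := by
  have h := hE.add' (l := a * d / q) (x := J) (y := a * u) (u := u ^ 3) (v := a / b)
    (by positivity) (by positivity) (by positivity) (by positivity) (by positivity)
  rw [show J * (a * u) = a * (J * u) by ring,
    show a * d / q * J / (a * u) = d / q * (J / u) by field_simp,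
    show u ^ 3 * (a / b) = a / b * u ^ 3 by ring,
    show a * d / q * u ^ 3 / (a / b) = a / c * u ^ 3 by field_simp; linear_combination hbal,
    show J * (a / b) = a / b * J by ring,
    show a * d / q * J / (a / b) = a / c * J by field_simp; linear_combination hbal,
    show u ^ 3 * (a * u) = a * u ^ 4 by ring,
    show a * d / q * u ^ 3 / (a * u) = d / q * u ^ 2 by field_simp,
    show a * u * (a / b) / (a * d / q) = c * u by field_simp; linear_combination -hbal,
    show a * u / (a / b) = b * u by field_simp,
    show a * d / q * J * u ^ 3 = a * d / q * (J * u ^ 3) by ring] at h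
  linear_combination h

/-- The common factor of the summand and the antidifference in `sum_cubicInner`. -/
noncomputable def cubicCom (E : ℂ → ℂ) (q a b c d : ℂ) (j k : ℕ) : ℂ :=
  efac E q (d / q) (3 * j - k) * efac E (q ^ 3) (a * d / q) (j + k) * efac E q b k * efac E q c k /
    (efac E (q ^ 3) (q ^ 3) (j - k) * efac E q (a * q) (3 * j + k) *
      efac E (q ^ 3) (a * q ^ 3 / b) k * efac E (q ^ 3) (a * q ^ 3 / c) k) *
    (d ^ k * (q ^ (k ^ 2) / q ^ (2 * k)))

/-- The nonvanishing of the denominators in the cubic summation and transformation. -/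
structure CubicNonzero (E : ℂ → ℂ) (q a b c d : ℂ) (n : ℕ) : Prop where
  q_ne : ∀ m < n, E (q ^ 3 * (q ^ 3) ^ m) ≠ 0
  a_ne : ∀ m ≤ 4 * n, E (a * q ^ m) ≠ 0
  l_ne : ∀ m ≤ 2 * n, E (a * d / q * (q ^ 3) ^ m) ≠ 0
  b_ne : ∀ m ≤ n, E (a / b * (q ^ 3) ^ m) ≠ 0
  c_ne : ∀ m ≤ n, E (a / c * (q ^ 3) ^ m) ≠ 0
  d_ne : ∀ m < 3 * n, E (a * q / d * q ^ m) ≠ 0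
  d_ne' : E (d / q) ≠ 0

theorem CubicNonzero.mono {m n : ℕ} (hmn : m ≤ n) (h : CubicNonzero E q a b c d n) :
    CubicNonzero E q a b c d m :=
  ⟨fun i hi => h.q_ne i (by omega), fun i hi => h.a_ne i (by omega),
    fun i hi => h.l_ne i (by omega), fun i hi => h.b_ne i (by omega),
    fun i hi => h.c_ne i (by omega), fun i hi => h.d_ne i (by omega), h.d_ne'⟩

theorem CubicNonzero.b_ne' {n : ℕ} (h : CubicNonzero E q a b c d n) {m : ℕ} (hm : m < n) :
    E (a * q ^ 3 / b * (q ^ 3) ^ m) ≠ 0 := by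
  rw [show a * q ^ 3 / b * (q ^ 3) ^ m = a / b * (q ^ 3) ^ (m + 1) by ring]
  exact h.b_ne _ (by omega)

theorem CubicNonzero.c_ne' {n : ℕ} (h : CubicNonzero E q a b c d n) {m : ℕ} (hm : m < n) :
    E (a * q ^ 3 / c * (q ^ 3) ^ m) ≠ 0 := by
  rw [show a * q ^ 3 / c * (q ^ 3) ^ m = a / c * (q ^ 3) ^ (m + 1) by ring]
  exact h.c_ne _ (by omega)

theorem CubicNonzero.efac_a {n : ℕ} (h : CubicNonzero E q a b c d n) {m : ℕ} (hm : m ≤ 4 * n) :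
    efac E q (a * q) m ≠ 0 := efac_ne_zero fun i hi => by
  rw [mul_assoc, ← pow_succ']; exact h.a_ne _ (by omega)

theorem cubicCom_succ (hq : q ≠ 0) (k m : ℕ) (h : CubicNonzero E q a b c d (k + m + 1)) :
    cubicCom E q a b c d (k + m + 1) (k + 1) *
      (E (d / q * q ^ (2 * k + 3 * m + 2)) * E (a * q ^ (4 * k + 3 * m + 4)) *
        (E (a / b * (q ^ 3) ^ (k + 1)) * E (a / c * (q ^ 3) ^ (k + 1)))) =
    cubicCom E q a b c d (k + m + 1) k * (d * q ^ (2 * k) / q *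
      (E (a * d / q * (q ^ 3) ^ (2 * k + m + 1)) * E ((q ^ 3) ^ (m + 1))) *
        (E (b * q ^ k) * E (c * q ^ k))) := by
  have h1 := h.q_ne m (by omega); rw [← pow_succ'] at h1
  have h2 := h.a_ne (4 * k + 3 * m + 4) (by omega)
  have h3 := h.b_ne (k + 1) (by omega)
  have h4 := h.c_ne (k + 1) (by omega)
  have eb : a * q ^ 3 / b * (q ^ 3) ^ k = a / b * (q ^ 3) ^ (k + 1) := by ring
  have ec : a * q ^ 3 / c * (q ^ 3) ^ k = a / c * (q ^ 3) ^ (k + 1) := by ring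
  rw [cubicCom, cubicCom, show 3 * (k + m + 1) - (k + 1) = 2 * k + 3 * m + 2 by omega,
    show 3 * (k + m + 1) - k = 2 * k + 3 * m + 2 + 1 by omega,
    show k + m + 1 + (k + 1) = 2 * k + m + 1 + 1 by ring,
    show k + m + 1 + k = 2 * k + m + 1 by ring, show k + m + 1 - (k + 1) = m by omega,
    show k + m + 1 - k = m + 1 by omega,
    show 3 * (k + m + 1) + (k + 1) = 4 * k + 3 * m + 3 + 1 by ring,
    show 3 * (k + m + 1) + k = 4 * k + 3 * m + 3 by ring,
    efac_succ (d / q) (2 * k + 3 * m + 2), efac_succ (a * d / q), efac_succ b, efac_succ c, efac_succ (q ^ 3),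
    efac_succ (a * q), efac_succ (a * q ^ 3 / b), efac_succ (a * q ^ 3 / c), eb, ec, ← pow_succ',
    show a * q * q ^ (4 * k + 3 * m + 3) = a * q ^ (4 * k + 3 * m + 4) by ring,
    show q ^ ((k + 1) ^ 2) / q ^ (2 * (k + 1)) = q ^ (k ^ 2) / q ^ (2 * k) * (q ^ (2 * k) / q) by
      field_simp; ring, pow_succ d k]
  generalize E ((q ^ 3) ^ (m + 1)) = x₁ at *
  generalize E (a * q ^ (4 * k + 3 * m + 4)) = x₂ at *
  generalize E (a / b * (q ^ 3) ^ (k + 1)) = x₃ at *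
  generalize E (a / c * (q ^ 3) ^ (k + 1)) = x₄ at *
  have hcancel : ∀ L R : ℂ, x₁ * x₁⁻¹ * L = x₂ * x₂⁻¹ * (x₃ * x₃⁻¹) * (x₄ * x₄⁻¹) * R → L = R := by
    intro L R hLR
    simpa [mul_inv_cancel₀, h1, h2, h3, h4] using hLR
  refine hcancel _ _ ?_
  ring

/-- A cubic summation formula, by telescoping. -/
theorem sum_cubicCom (hE : IsTheta E) (hq : q ≠ 0) (ha : a ≠ 0) (hb : b ≠ 0)
    (hc : c ≠ 0) (hd : d ≠ 0) (hbal : b * c * d = a * q) (j : ℕ)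
    (h : CubicNonzero E q a b c d j) :
    ∑ k ∈ Finset.range (j + 1), cubicCom E q a b c d j k *
      (E (a * q ^ (4 * k)) * E (d / q * q ^ (2 * k))) =
    E (d / q) * E a * (efac E (q ^ 3) (a * d / q) j * efac E q d (3 * j) *
      (efac E (q ^ 3) (a / b) j * efac E (q ^ 3) (a / c) j) /
      (efac E (q ^ 3) (q ^ 3) j * efac E q a (3 * j) *
        (efac E (q ^ 3) (a * q ^ 3 / b) j * efac E (q ^ 3) (a * q ^ 3 / c) j))) := by
  set V : ℕ → ℂ := fun k => cubicCom E q a b c d j k * (E (d / q * q ^ (3 * j - k)) *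
    E (a * q ^ (3 * j + k)) * (E (a / b * (q ^ 3) ^ k) * E (a / c * (q ^ 3) ^ k))) with hV
  have hadd : ∀ k ≤ j, E (d / q * q ^ (3 * j - k)) * E (a * q ^ (3 * j + k)) *
      (E (a / b * (q ^ 3) ^ k) * E (a / c * (q ^ 3) ^ k)) -
      d * q ^ (2 * k) / q * (E (a * d / q * (q ^ 3) ^ (j + k)) * E ((q ^ 3) ^ (j - k))) *
        (E (b * q ^ k) * E (c * q ^ k)) =
      E (a * q ^ (4 * k)) * E (d / q * q ^ (2 * k)) *
        (E (a / b * (q ^ 3) ^ j) * E (a / c * (q ^ 3) ^ j)) := by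
    intro k hk
    have := hE.add_cubic hq ha hb hc hd (pow_ne_zero j (pow_ne_zero 3 hq)) (pow_ne_zero k hq) hbal
    obtain ⟨m, rfl⟩ := Nat.exists_eq_add_of_le hk
    have hqk := pow_ne_zero k hq
    rw [show (q ^ 3) ^ (k + m) / q ^ k = q ^ (2 * k + 3 * m) by rw [div_eq_iff hqk]; ring,
      show (q ^ 3) ^ (k + m) * q ^ k = q ^ (3 * (k + m) + k) by ring,
      show (q ^ k) ^ 3 = (q ^ 3) ^ k by ring,
      show (q ^ 3) ^ (k + m) * (q ^ 3) ^ k = (q ^ 3) ^ (k + m + k) by ring,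
      show (q ^ 3) ^ (k + m) / (q ^ 3) ^ k = (q ^ 3) ^ m by
        rw [div_eq_iff (pow_ne_zero k (pow_ne_zero 3 hq))]; ring,
      show (q ^ k) ^ 2 = q ^ (2 * k) by ring, show (q ^ k) ^ 4 = q ^ (4 * k) by ring] at this
    rw [show 3 * (k + m) - k = 2 * k + 3 * m by omega, show k + m - k = m by omega]
    exact this
  have step : ∀ m ≤ j, (∑ k ∈ Finset.range m, cubicCom E q a b c d j k *
      (E (a * q ^ (4 * k)) * E (d / q * q ^ (2 * k)))) *
        (E (a / b * (q ^ 3) ^ j) * E (a / c * (q ^ 3) ^ j)) = V 0 - V m := by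
    intro m
    induction m with
    | zero => simp
    | succ k ih =>
      intro hk
      obtain ⟨m, rfl⟩ := Nat.exists_eq_add_of_lt (show k < j from hk)
      have h1 := cubicCom_succ hq k m h
      have h2 := hadd k (by omega)
      rw [Finset.sum_range_succ, add_mul, ih (by omega)]
      simp only [hV]
      rw [show 3 * (k + m + 1) - (k + 1) = 2 * k + 3 * m + 2 by omega,
        show 3 * (k + m + 1) + (k + 1) = 4 * k + 3 * m + 4 by ring, h1]
      rw [show k + m + 1 + k = 2 * k + m + 1 by ring, show k + m + 1 - k = m + 1 by omega] at h2
      linear_combination (-cubicCom E q a b c d (k + m + 1) k) * h2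
  have h2 := hadd j le_rfl
  rw [Nat.sub_self, pow_zero, hE.one] at h2
  have hsum := step j le_rfl
  have htot : (∑ k ∈ Finset.range (j + 1), cubicCom E q a b c d j k *
      (E (a * q ^ (4 * k)) * E (d / q * q ^ (2 * k)))) *
        (E (a / b * (q ^ 3) ^ j) * E (a / c * (q ^ 3) ^ j)) = V 0 := by
    rw [Finset.sum_range_succ, add_mul, hsum]
    simp only [hV]
    linear_combination (-cubicCom E q a b c d j j) * h2
  have hbj := h.b_ne j le_rfl
  have hcj := h.c_ne j le_rfl
  have hb' : efac E (q ^ 3) (a * q ^ 3 / b) j ≠ 0 := efac_ne_zero fun i hi => h.b_ne' hi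
  have hc' : efac E (q ^ 3) (a * q ^ 3 / c) j ≠ 0 := efac_ne_zero fun i hi => h.c_ne' hi
  have key : ∀ x, efac E (q ^ 3) (a / x) j * E (a / x * (q ^ 3) ^ j) =
      E (a / x) * efac E (q ^ 3) (a * q ^ 3 / x) j := fun x => by
    rw [← efac_succ, efac_succ', show a / x * q ^ 3 = a * q ^ 3 / x by ring]
  have kd : efac E q (d / q) (3 * j) * E (d / q * q ^ (3 * j)) = E (d / q) * efac E q d (3 * j) := by
    rw [← efac_succ, efac_succ', show d / q * q = d by field_simp]
  have ka : efac E q a (3 * j) * E (a * q ^ (3 * j)) = E a * efac E q (a * q) (3 * j) := by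
    rw [← efac_succ, efac_succ']
  have ha1 := h.efac_a (show 3 * j ≤ _ by omega)
  have ha2 : efac E q a (3 * j) ≠ 0 := efac_ne_zero fun i hi => h.a_ne _ (by omega)
  have hV0 : V 0 = efac E q (d / q) (3 * j) * E (d / q * q ^ (3 * j)) *
      (efac E (q ^ 3) (a * d / q) j / efac E (q ^ 3) (q ^ 3) j) *
      (E (a * q ^ (3 * j)) / efac E q (a * q) (3 * j)) * (E (a / b) * E (a / c)) := by
    simp only [hV, cubicCom, efac_zero]
    simp only [Nat.sub_zero, add_zero, pow_zero, mul_zero, mul_one, one_mul, div_one]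
    ring
  apply mul_right_cancel₀ (mul_ne_zero hbj hcj)
  rw [htot, hV0, kd, show E (a * q ^ (3 * j)) / efac E q (a * q) (3 * j) = E a / efac E q a (3 * j) by
    rw [div_eq_div_iff ha1 ha2]; linear_combination ka]
  have kb := key b
  have kc := key c
  have : efac E (q ^ 3) (a / b) j / efac E (q ^ 3) (a * q ^ 3 / b) j * E (a / b * (q ^ 3) ^ j) =
    E (a / b) := by
    rw [div_mul_eq_mul_div, kb, mul_div_cancel_right₀ _ hb']
  rw [← this]
  have : efac E (q ^ 3) (a / c) j / efac E (q ^ 3) (a * q ^ 3 / c) j * E (a / c * (q ^ 3) ^ j) =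
    E (a / c) := by
    rw [div_mul_eq_mul_div, kc, mul_div_cancel_right₀ _ hc']
  rw [← this]
  ring

end Cubic

section CubicTransformation

variable {E : ℂ → ℂ} {q a b c d : ℂ}

/-- The summand on the left of the cubic transformation, with terms independent of the summation
index removed. -/
noncomputable def cubicTerm (E : ℂ → ℂ) (q a b c d : ℂ) (n k : ℕ) : ℂ :=
  E (a * q ^ (4 * k)) / E a *
    (efac E q b k * efac E q c k /
      (efac E (q ^ 3) (a * q ^ 3 / b) k * efac E (q ^ 3) (a * q ^ 3 / c) k)) *
    (efac E q d (2 * k) / efac E q (a * q / d) (2 * k)) *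
    (efac E (q ^ 3) (a ^ 2 * q / d) (n + k) * efac E q (a * q / d) (3 * n - k) /
      (efac E (q ^ 3) (q ^ 3) (n - k) * efac E q (a * q) (3 * n + k))) *
    ((a / d) ^ k * q ^ (k ^ 2))

theorem cubic_double (hq : q ≠ 0) (ha : a ≠ 0) (hd : d ≠ 0) (k i m : ℕ)
    (hl0 : E (a * d / q) ≠ 0) (hl : E (a * d / q * (q ^ 3) ^ (2 * k)) ≠ 0)
    (hlq : efac E (q ^ 3) (a * d / q * q ^ 3) (2 * k) ≠ 0) :
    wpKernel E (q ^ 3) (a * d / q) (a ^ 2 * q / d) (k + m) (k + i) *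
      (E (a * d / q * (q ^ 3) ^ (2 * (k + i))) / E (a * d / q)) *
      (a ^ 2 * q / d / (a * d / q)) ^ (k + i) *
      (cubicCom E q a b c d (k + i) k * (E (a * q ^ (4 * k)) * E (d / q * q ^ (2 * k))) /
        (E (d / q) * E a)) =
    efac E (q ^ 3) (a ^ 2 * q / d) (2 * k) * (a ^ 2 * q / d / (a * d / q)) ^ k *
      (efac E q (d / q) (2 * k) / efac E q (a * q) (4 * k)) *
      (efac E q b k * efac E q c k /
        (efac E (q ^ 3) (a * q ^ 3 / b) k * efac E (q ^ 3) (a * q ^ 3 / c) k)) *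
      (E (a * q ^ (4 * k)) * E (d / q * q ^ (2 * k)) / (E (d / q) * E a)) *
      (d ^ k * (q ^ (k ^ 2) / q ^ (2 * k))) *
      ftTerm E (q ^ 3) (a * d / q * (q ^ 3) ^ (2 * k)) (d / q * q ^ (2 * k))
        (d / q * q ^ (2 * k) * q) (d / q * q ^ (2 * k) * q ^ 2)
        (a ^ 2 * q / d * (q ^ 3) ^ (2 * k)) m i := by
  have h1 : efac E (q ^ 3) (a * d / q) (2 * k) = E (a * d / q) *
      efac E (q ^ 3) (a * d / q * q ^ 3) (2 * k) / E (a * d / q * (q ^ 3) ^ (2 * k)) := by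
    rw [eq_div_iff hl, ← efac_succ, efac_succ']
  have hcom : cubicCom E q a b c d (k + i) k =
      efac E q (d / q) (2 * k) * (efac E (q ^ 3) (d / q * q ^ (2 * k)) i *
        efac E (q ^ 3) (d / q * q ^ (2 * k) * q) i * efac E (q ^ 3) (d / q * q ^ (2 * k) * q ^ 2) i) *
      (efac E (q ^ 3) (a * d / q) (2 * k) *
        efac E (q ^ 3) (a * d / q * (q ^ 3) ^ (2 * k)) i) * efac E q b k * efac E q c k /
      (efac E (q ^ 3) (q ^ 3) i * (efac E q (a * q) (4 * k) *
        (efac E (q ^ 3) (a * q * q ^ (4 * k)) i * efac E (q ^ 3) (a * q * q ^ (4 * k) * q) i *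
          efac E (q ^ 3) (a * q * q ^ (4 * k) * q ^ 2) i)) *
        efac E (q ^ 3) (a * q ^ 3 / b) k * efac E (q ^ 3) (a * q ^ 3 / c) k) *
      (d ^ k * (q ^ (k ^ 2) / q ^ (2 * k))) := by
    rw [cubicCom, show 3 * (k + i) - k = 2 * k + 3 * i by omega, show k + i + k = 2 * k + i by ring,
      show k + i - k = i by omega, show 3 * (k + i) + k = 4 * k + 3 * i by ring,
      efac_add (d / q), efac_add (a * d / q), efac_add (a * q), efac_three_mul, efac_three_mul]
  rw [wpKernel_add (pow_ne_zero 3 hq), ftTerm, hcom, h1,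
    show a * d / q * (q ^ 3) ^ (2 * k) * q ^ 3 / (d / q * q ^ (2 * k)) =
      a * q * q ^ (4 * k) * q ^ 2 by field_simp; ring,
    show a * d / q * (q ^ 3) ^ (2 * k) * q ^ 3 / (d / q * q ^ (2 * k) * q) =
      a * q * q ^ (4 * k) * q by field_simp; ring,
    show a * d / q * (q ^ 3) ^ (2 * k) * q ^ 3 / (d / q * q ^ (2 * k) * q ^ 2) =
      a * q * q ^ (4 * k) by field_simp; ring,
    show a ^ 2 * q / d * (q ^ 3) ^ (2 * k) / (a * d / q * (q ^ 3) ^ (2 * k)) =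
      a ^ 2 * q / d / (a * d / q) by field_simp,
    show a * d / q * (q ^ 3) ^ (2 * k) * (q ^ 3) ^ (2 * i) =
      a * d / q * (q ^ 3) ^ (2 * (k + i)) by ring,
    pow_add (a ^ 2 * q / d / (a * d / q)) k i]
  generalize wpKernel E (q ^ 3) (a * d / q * (q ^ 3) ^ (2 * k))
    (a ^ 2 * q / d * (q ^ 3) ^ (2 * k)) m i = w at *
  generalize a ^ 2 * q / d / (a * d / q) = t at *
  generalize a * d / q = l at *
  generalize efac E (q ^ 3) (l * q ^ 3) (2 * k) = x₁ at *
  generalize E l = x₂ at *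
  refine eq_of_eq_mul_inv_mul hlq hl0 ?_
  ring

/-- A cubic transformation formula, in kernel form. -/
theorem sum_cubicTerm (hE : IsTheta E) (hq : q ≠ 0) (ha : a ≠ 0) (hb : b ≠ 0)
    (hc : c ≠ 0) (hd : d ≠ 0) (hbal : b * c * d = a * q) (n : ℕ)
    (h : CubicNonzero E q a b c d n) :
    ∑ k ∈ Finset.range (n + 1), cubicTerm E q a b c d n k =
      ∑ j ∈ Finset.range (n + 1), tenTerm E (q ^ 3) (a * d / q) (a / b) (a / c) d (d * q)
        (d * q ^ 2) (a ^ 2 * q / d) n j := by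
  have hE0 : E a ≠ 0 := by simpa using h.a_ne 0 (by omega)
  have hl0 : E (a * d / q) ≠ 0 := by simpa using h.l_ne 0 (by omega)
  have step1 : ∀ j ∈ Finset.range (n + 1), tenTerm E (q ^ 3) (a * d / q) (a / b) (a / c) d (d * q)
        (d * q ^ 2) (a ^ 2 * q / d) n j = ∑ k ∈ Finset.range (j + 1),
      wpKernel E (q ^ 3) (a * d / q) (a ^ 2 * q / d) n j *
      (E (a * d / q * (q ^ 3) ^ (2 * j)) / E (a * d / q)) *
      (a ^ 2 * q / d / (a * d / q)) ^ j *
      (cubicCom E q a b c d j k * (E (a * q ^ (4 * k)) * E (d / q * q ^ (2 * k))) /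
        (E (d / q) * E a)) := by
    intro j hj
    have hj' := Finset.mem_range.1 hj
    rw [← Finset.mul_sum, ← Finset.sum_div,
      sum_cubicCom hE hq ha hb hc hd hbal j (h.mono (by omega)),
      mul_div_cancel_left₀ _ (mul_ne_zero h.d_ne' hE0), tenTerm,
      show a * d / q * q ^ 3 / (a / b) = a * q ^ 3 / c by
        field_simp; linear_combination hbal,
      show a * d / q * q ^ 3 / (a / c) = a * q ^ 3 / b by
        field_simp; linear_combination hbal,
      show a * d / q * q ^ 3 / d = a * q ^ 2 by field_simp,
      show a * d / q * q ^ 3 / (d * q) = a * q by field_simp,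
      show a * d / q * q ^ 3 / (d * q ^ 2) = a by field_simp, efac_three_mul, efac_three_mul]
    ring
  rw [Finset.sum_congr rfl step1, sum_range_sum_range_succ]
  refine Finset.sum_congr rfl fun k hk => ?_
  obtain ⟨m, rfl⟩ := Nat.exists_eq_add_of_le (show k ≤ n by simpa [Nat.lt_succ_iff] using hk)
  rw [show k + m - k = m by omega]
  have hlq : efac E (q ^ 3) (a * d / q * q ^ 3) (2 * k) ≠ 0 := efac_ne_zero fun i hi => by
    rw [mul_assoc, ← pow_succ']; exact h.l_ne _ (by omega)
  have e1 : a * d / q * (q ^ 3) ^ (2 * k) * q ^ 3 / (d / q * q ^ (2 * k)) =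
      a * q * q ^ (4 * k) * q ^ 2 := by field_simp; ring
  have e2 : a * d / q * (q ^ 3) ^ (2 * k) * q ^ 3 / (d / q * q ^ (2 * k) * q) =
      a * q * q ^ (4 * k) * q := by field_simp; ring
  have e3 : a * d / q * (q ^ 3) ^ (2 * k) * q ^ 3 / (d / q * q ^ (2 * k) * q ^ 2) =
      a * q * q ^ (4 * k) := by field_simp; ring
  have hft : FTNonzero E (q ^ 3) (a * d / q * (q ^ 3) ^ (2 * k)) (d / q * q ^ (2 * k))
      (d / q * q ^ (2 * k) * q) (d / q * q ^ (2 * k) * q ^ 2) m := by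
    refine ⟨fun i hi => h.q_ne i (by omega), fun i hi => ?_, fun i hi => ?_, fun i hi => ?_,
      fun i hi => ?_⟩
    · rw [mul_assoc, ← pow_add]; exact h.l_ne _ (by omega)
    · rw [e1, show a * q * q ^ (4 * k) * q ^ 2 * (q ^ 3) ^ i = a * q ^ (4 * k + 3 * i + 3) by ring]
      exact h.a_ne _ (by omega)
    · rw [e2, show a * q * q ^ (4 * k) * q * (q ^ 3) ^ i = a * q ^ (4 * k + 3 * i + 2) by ring]
      exact h.a_ne _ (by omega)
    · rw [e3, show a * q * q ^ (4 * k) * (q ^ 3) ^ i = a * q ^ (4 * k + 3 * i + 1) by ring]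
      exact h.a_ne _ (by omega)
  rw [Finset.sum_congr rfl fun i _ => cubic_double hq ha hd k i m hl0 (h.l_ne _ (by omega)) hlq,
    ← Finset.mul_sum, frenkel_turaev hE (pow_ne_zero 3 hq) m (by positivity) (by positivity)
      (by positivity) (by positivity) (by positivity) (by field_simp; ring) hft]
  have hd1 : efac E q (a * q / d) (2 * k) ≠ 0 := efac_ne_zero fun i hi => h.d_ne _ (by omega)
  have kd : E (d / q * q ^ (2 * k)) * efac E q (d / q) (2 * k) / E (d / q) = efac E q d (2 * k) := by
    rw [div_eq_iff h.d_ne', mul_comm, ← efac_succ, efac_succ', show d / q * q = d by field_simp,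
      mul_comm]
  rw [ftSum, e1, e2, e3, cubicTerm, ← kd, show k + m + k = 2 * k + m by ring,
    show 3 * (k + m) - k = 2 * k + 3 * m by omega, show k + m - k = m by omega,
    show 3 * (k + m) + k = 4 * k + 3 * m by ring, efac_add (a ^ 2 * q / d),
    efac_add (a * q / d), efac_add (a * q), efac_three_mul (a * q / d * q ^ (2 * k)),
    efac_three_mul (a * q * q ^ (4 * k)),
    show a ^ 2 * q / d * (q ^ 3) ^ (2 * k) * (d / q * q ^ (2 * k)) /
      (a * d / q * (q ^ 3) ^ (2 * k)) = a * q / d * q ^ (2 * k) by field_simp,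
    show a ^ 2 * q / d * (q ^ 3) ^ (2 * k) * (d / q * q ^ (2 * k) * q) /
      (a * d / q * (q ^ 3) ^ (2 * k)) = a * q / d * q ^ (2 * k) * q by field_simp,
    show a ^ 2 * q / d * (q ^ 3) ^ (2 * k) * (d / q * q ^ (2 * k) * q ^ 2) /
      (a * d / q * (q ^ 3) ^ (2 * k)) = a * q / d * q ^ (2 * k) * q ^ 2 by field_simp,
    show (a / d) ^ k * q ^ (k ^ 2) = (a ^ 2 * q / d / (a * d / q)) ^ k *
      (d ^ k * (q ^ (k ^ 2) / q ^ (2 * k))) by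
        rw [show a ^ 2 * q / d / (a * d / q) = a * q ^ 2 / d ^ 2 by field_simp]
        simp only [div_pow, mul_pow]; field_simp; ring]
  generalize efac E q (a * q / d) (2 * k) = x at *
  refine eq_of_eq_mul_inv_mul hd1 one_ne_zero ?_
  ring

end CubicTransformation

section GenericParameters

variable {E : ℂ → ℂ} {q a b c d e : ℂ}

/-- The summand on the left of the cubic transformation. -/
noncomputable def cubicSummand (E : ℂ → ℂ) (q a b c d e : ℂ) (n k : ℕ) : ℂ :=
  E (a * q ^ (4 * k)) / E a *
    (efac E q b k * efac E q c k /
      (efac E (q ^ 3) (a * q ^ 3 / b) k * efac E (q ^ 3) (a * q ^ 3 / c) k)) *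
    (efac E q d (2 * k) / efac E q (a * q / d) (2 * k)) *
    (efac E (q ^ 3) e k * efac E (q ^ 3) ((q ^ 3) ^ n)⁻¹ k /
      (efac E q (a * q / e) k * efac E q (a * q ^ (3 * n + 1)) k)) * q ^ k

theorem two_mul_choose_succ_two (k : ℕ) : 2 * (k + 1).choose 2 = k ^ 2 + k := by
  induction k with
  | zero => rfl
  | succ k ih =>
    rw [Nat.choose_succ_succ' (k + 1) 1, Nat.choose_one_right, mul_add, ih]
    ring

theorem cubicSummand_eq (hE : IsTheta E) (hq : q ≠ 0) (ha : a ≠ 0) (hd : d ≠ 0) {n k : ℕ}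
    (hde : d * e = a ^ 2 * q ^ (3 * n + 1)) (hk : k ≤ n)
    (h1 : efac E (q ^ 3) (q ^ 3) n ≠ 0) (h2 : efac E q (a * q / d) (3 * n) ≠ 0) :
    efac E (q ^ 3) (a ^ 2 * q / d) n * efac E q (a * q / d) (3 * n) /
      (efac E (q ^ 3) (q ^ 3) n * efac E q (a * q) (3 * n)) * cubicSummand E q a b c d e n k =
      cubicTerm E q a b c d n k := by
  have hq3 : q ^ 3 ≠ 0 := pow_ne_zero 3 hq
  obtain rfl : e = a ^ 2 * q / d * (q ^ 3) ^ n := by field_simp; linear_combination hde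
  have f1 := efac_flip hE hq3 hq3 hk
  have f2 := efac_flip hE hq (x := a * q / d) (by positivity) (show k ≤ 3 * n by omega)
  rw [show q ^ 3 / (q ^ 3 * (q ^ 3) ^ n) = ((q ^ 3) ^ n)⁻¹ by field_simp] at f1
  rw [show q / (a * q / d * q ^ (3 * n)) = a * q / (a ^ 2 * q / d * (q ^ 3) ^ n) by
    rw [pow_mul]; field_simp] at f2
  have h1' : efac E (q ^ 3) (q ^ 3) (n - k) ≠ 0 := by
    obtain ⟨i, rfl⟩ := Nat.exists_eq_add_of_le' hk
    rw [efac_add] at h1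
    rw [Nat.add_sub_cancel]
    exact left_ne_zero_of_mul h1
  have h2' : efac E q (a * q / d) (3 * n - k) ≠ 0 := by
    obtain ⟨i, hi⟩ := Nat.exists_eq_add_of_le' (show k ≤ 3 * n by omega)
    rw [hi, efac_add] at h2
    rw [hi, Nat.add_sub_cancel]
    exact left_ne_zero_of_mul h2
  have f1' : efac E (q ^ 3) ((q ^ 3) ^ n)⁻¹ k = (-1) ^ k * (q ^ 3) ^ ((k + 1).choose 2) *
      efac E (q ^ 3) (q ^ 3) n / (efac E (q ^ 3) (q ^ 3) (n - k) * (q ^ 3 * (q ^ 3) ^ n) ^ k) := by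
    rw [eq_div_iff (by positivity), ← f1]; ring
  have f2' : efac E q (a * q / (a ^ 2 * q / d * (q ^ 3) ^ n)) k =
      (-1) ^ k * q ^ ((k + 1).choose 2) * efac E q (a * q / d) (3 * n) /
        (efac E q (a * q / d) (3 * n - k) * (a * q / d * q ^ (3 * n)) ^ k) := by
    rw [eq_div_iff (by positivity), ← f2]; ring
  have hmain : efac E (q ^ 3) ((q ^ 3) ^ n)⁻¹ k * q ^ k * efac E q (a * q / d) (3 * n) /
      (efac E q (a * q / (a ^ 2 * q / d * (q ^ 3) ^ n)) k * efac E (q ^ 3) (q ^ 3) n) =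
      efac E q (a * q / d) (3 * n - k) / efac E (q ^ 3) (q ^ 3) (n - k) *
        ((a / d) ^ k * q ^ (k ^ 2)) := by
    rw [f1', f2']
    have hpow : (q ^ 3) ^ ((k + 1).choose 2) = q ^ ((k + 1).choose 2) * (q ^ (k ^ 2) * q ^ k) := by
      rw [← pow_add q (k ^ 2), ← two_mul_choose_succ_two]; ring
    rw [hpow]
    simp only [mul_pow, div_pow]
    rw [show ((q ^ 3) ^ n) = q ^ (3 * n) by ring, show (q ^ 3) ^ k = q ^ k * (q ^ k * q ^ k) by ring]
    have hs : (-1) ^ k * q ^ ((k + 1).choose 2) ≠ 0 := by simp [hq]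
    have t1 := pow_ne_zero k (pow_ne_zero (3 * n) hq)
    have t2 := pow_ne_zero k hq
    have t3 := pow_ne_zero k ha
    have t4 := pow_ne_zero k hd
    clear f1 f1' f2 f2' hpow
    rw [← mul_assoc ((-1) ^ k)]
    generalize (-1) ^ k * q ^ ((k + 1).choose 2) = s at *
    generalize (q ^ (3 * n)) ^ k = u at *
    generalize q ^ k = v at *
    generalize a ^ k = w at *
    generalize d ^ k = x at *
    generalize efac E q (a * q / d) (3 * n) = y at *
    generalize efac E q (a * q / d) (3 * n - k) = y' at *
    field_simp
  rw [cubicSummand, cubicTerm, efac_add (a ^ 2 * q / d) n k, efac_add (a * q) (3 * n) k,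
    show a * q * q ^ (3 * n) = a * q ^ (3 * n + 1) by ring]
  linear_combination (E (a * q ^ (4 * k)) / E a *
    (efac E q b k * efac E q c k /
      (efac E (q ^ 3) (a * q ^ 3 / b) k * efac E (q ^ 3) (a * q ^ 3 / c) k)) *
    (efac E q d (2 * k) / efac E q (a * q / d) (2 * k)) * (efac E (q ^ 3) (a ^ 2 * q / d) n *
      efac E (q ^ 3) (a ^ 2 * q / d * (q ^ 3) ^ n) k / (efac E q (a * q) (3 * n) *
        efac E q (a * q ^ (3 * n + 1)) k))) * hmain

/-- Genericity of the parameters. -/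
structure Generic (E : ℂ → ℂ) (q a b d : ℂ) (n : ℕ) : Prop where
  q_ne : ∀ m < n, E (q ^ 3 * (q ^ 3) ^ m) ≠ 0
  ne : ∀ i j l i' j' l' M M' : ℕ, i ≤ 2 → j ≤ 2 → l ≤ 2 → i' ≤ 2 → j' ≤ 2 → l' ≤ 2 →
    (i ≠ i' ∨ j ≠ j' ∨ l ≠ l') →
      E (a ^ i * b ^ j * d ^ l * q ^ M / (a ^ i' * b ^ j' * d ^ l' * q ^ M')) ≠ 0

theorem Generic.ne_zero {n : ℕ} (h : Generic E q a b d n) (hq : q ≠ 0) (ha : a ≠ 0) (hb : b ≠ 0)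
    (hd : d ≠ 0) (i j l i' j' l' M M' : ℕ) {x : ℂ}
    (hx : x * (a ^ i' * b ^ j' * d ^ l' * q ^ M') = a ^ i * b ^ j * d ^ l * q ^ M)
    (hi : i ≤ 2 ∧ j ≤ 2 ∧ l ≤ 2 ∧ i' ≤ 2 ∧ j' ≤ 2 ∧ l' ≤ 2 ∧ (i ≠ i' ∨ j ≠ j' ∨ l ≠ l')) :
    E x ≠ 0 := by
  obtain ⟨h1, h2, h3, h4, h5, h6, h7⟩ := hi
  rw [eq_div_of_mul_eq (by positivity) hx]
  exact h.ne i j l i' j' l' M M' h1 h2 h3 h4 h5 h6 h7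

theorem Generic.cubicNonzero {n : ℕ} (hq : q ≠ 0) (ha : a ≠ 0) (hb : b ≠ 0) (hc : c ≠ 0)
    (hd : d ≠ 0) (hbal : b * c * d = a * q) (h : Generic E q a b d n) :
    CubicNonzero E q a b c d n := by
  have hne := fun i j l i' j' l' M M' x =>
    Generic.ne_zero h hq ha hb hd i j l i' j' l' M M' (x := x)
  refine ⟨h.q_ne, fun m _ => ?_, fun m _ => ?_, fun m _ => ?_, fun m _ => ?_, fun m _ => ?_, ?_⟩
  · exact hne 1 0 0 0 0 0 m 0 _ (by ring) (by simp)
  · exact hne 1 0 1 0 0 0 (3 * m) 1 _ (by field_simp; ring) (by simp)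
  · exact hne 1 0 0 0 1 0 (3 * m) 0 _ (by field_simp; ring) (by simp)
  · exact hne 0 1 1 0 0 0 (3 * m) 1 _
      (by field_simp; linear_combination (-(q ^ (3 * m))) * hbal) (by simp)
  · exact hne 1 0 0 0 0 1 (m + 1) 0 _ (by field_simp; ring) (by simp)
  · exact hne 0 0 1 0 0 0 0 1 _ (by field_simp) (by simp)

/-- The cubic transformation with `f = a / b`, for generic parameters. -/
theorem cubic_transform_left (hE : IsTheta E) (hq : q ≠ 0) (ha : a ≠ 0) (hb : b ≠ 0) (hc : c ≠ 0)
    (hd : d ≠ 0) (hbal : b * c * d = a * q) {n : ℕ}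
    (hde : d * e = a ^ 2 * q ^ (3 * n + 1)) (h : Generic E q a b d n) :
    ∑ k ∈ Finset.range (n + 1), cubicSummand E q a b c d e n k =
      efac E (q ^ 3) (a * q ^ 3) n * efac E (q ^ 3) (a * d * q ^ 2 / e) n *
          efac E (q ^ 3) (a * q ^ 3 / (d * e)) n * efac E (q ^ 3) (a * q ^ 2) n /
        (efac E (q ^ 3) (a * q ^ 3 / e) n * efac E (q ^ 3) (a * d * q ^ 2) n *
          efac E (q ^ 3) (a * q ^ 3 / d) n * efac E (q ^ 3) (a * q ^ 2 / e) n) *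
      ∑ j ∈ Finset.range (n + 1), stdTerm E (q ^ 3) (a * d / q) (a / b) (a / c) d (d * q)
        (d * q ^ 2) e ((q ^ 3) ^ n)⁻¹ j := by
  have hne := fun i j l i' j' l' M M' x =>
    Generic.ne_zero h hq ha hb hd i j l i' j' l' M M' (x := x)
  have hcub := h.cubicNonzero hq ha hb hc hd hbal
  have hq3 : q ^ 3 ≠ 0 := pow_ne_zero 3 hq
  have hK : a ^ 2 * q / d ≠ 0 := by positivity
  have hl : a * d / q ≠ 0 := by positivity
  have heK : e = a ^ 2 * q / d * (q ^ 3) ^ n := by field_simp; linear_combination hde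
  have he : e ≠ 0 := by rw [heK]; positivity
  have n1 : efac E (q ^ 3) (q ^ 3) n ≠ 0 := efac_ne_zero h.q_ne
  have n2 : efac E q (a * q / d) (3 * n) ≠ 0 := efac_ne_zero hcub.d_ne
  have n3 : efac E (q ^ 3) (a ^ 2 * q / d / (a * d / q)) n ≠ 0 := efac_ne_zero fun m _ =>
    hne 1 0 0 0 0 2 (3 * m + 2) 0 _ (by field_simp; ring) (by simp)
  have n4 : efac E (q ^ 3) (a ^ 2 * q / d) n ≠ 0 := efac_ne_zero fun m _ =>
    hne 2 0 0 0 0 1 (3 * m + 1) 0 _ (by field_simp; ring) (by simp)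
  have n5 : efac E q (a * q) (3 * n) ≠ 0 := hcub.efac_a (by omega)
  have n6 : efac E (q ^ 3) (a * d / q * q ^ 3) n ≠ 0 := efac_ne_zero fun m _ =>
    hne 1 0 1 0 0 0 (3 * m + 2) 0 _ (by field_simp; ring) (by simp)
  have n8 : efac E (q ^ 3) (a * q ^ 3 / e) n ≠ 0 := efac_ne_zero fun m _ =>
    hne 0 0 1 1 0 0 (3 * m + 2) (3 * n) _ (by rw [heK]; field_simp; ring) (by simp)
  have n9 : efac E (q ^ 3) (a * q ^ 2 / e) n ≠ 0 := efac_ne_zero fun m _ =>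
    hne 0 0 1 1 0 0 (3 * m + 1) (3 * n) _ (by rw [heK]; field_simp; ring) (by simp)
  have hmain := sum_cubicTerm hE hq ha hb hc hd hbal n hcub
  rw [Finset.sum_congr rfl fun k hk => (cubicSummand_eq hE hq ha hd hde
      (show k ≤ n by simpa [Nat.lt_succ_iff] using hk) n1 n2).symm,
    Finset.sum_congr rfl fun j hj => (stdTerm_eq (n := n) hE hq3 hl hK
      (show j ≤ n by simpa [Nat.lt_succ_iff] using hj) n1 n3).symm,
    ← Finset.mul_sum, ← Finset.mul_sum, ← heK, wpKernel, Nat.sub_zero, add_zero] at hmain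
  have hw : efac E (q ^ 3) (a ^ 2 * q / d) n * efac E q (a * q / d) (3 * n) /
      (efac E (q ^ 3) (q ^ 3) n * efac E q (a * q) (3 * n)) ≠ 0 := by positivity
  apply mul_left_cancel₀ hw
  rw [hmain, ← mul_assoc]
  congr 1
  have flip : ∀ x y : ℂ, x ≠ 0 → y * (x * (q ^ 3) ^ n) = q ^ 3 → efac E (q ^ 3) y n *
      (x * (q ^ 3) ^ n) ^ n = (-1) ^ n * (q ^ 3) ^ ((n + 1).choose 2) * efac E (q ^ 3) x n := by
    intro x y hx hxy
    rw [← efac_flip hE hq3 hx le_rfl, Nat.sub_self, efac_zero, mul_one,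
      eq_div_of_mul_eq (by positivity) hxy]
  have g1 := flip (a * q) (a * q ^ 3 / (d * e)) (by positivity) (by rw [heK]; field_simp)
  have g2 := flip (a * q ^ 2 / d ^ 2) (a * d * q ^ 2 / e) (by positivity) (by rw [heK]; field_simp)
  have g3 := flip (a * q / d) (a * q ^ 3 / e) (by positivity) (by rw [heK]; field_simp)
  have g4 := flip (a * q ^ 2 / d) (a * q ^ 2 / e) (by positivity) (by rw [heK]; field_simp)
  rw [efac_three_mul, show a * q / d * q = a * q ^ 2 / d by ring,
    show a * q / d * q ^ 2 = a * q ^ 3 / d by ring] at n2 ⊢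
  rw [efac_three_mul, show a * q * q = a * q ^ 2 by ring,
    show a * q * q ^ 2 = a * q ^ 3 by ring] at n5 ⊢
  rw [show a ^ 2 * q / d / (a * d / q) = a * q ^ 2 / d ^ 2 by field_simp] at n3 ⊢
  rw [show a * d / q * q ^ 3 = a * d * q ^ 2 by field_simp] at n6 ⊢
  have hpow : (a * q * (q ^ 3) ^ n) ^ n * (a * q ^ 2 / d ^ 2 * (q ^ 3) ^ n) ^ n =
      (a * q / d * (q ^ 3) ^ n) ^ n * (a * q ^ 2 / d * (q ^ 3) ^ n) ^ n := by
    rw [← mul_pow, ← mul_pow]; congr 1; ring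
  have hs : (-1) ^ n * (q ^ 3) ^ ((n + 1).choose 2) ≠ 0 := by simp [hq]
  have p1 : (a * q * (q ^ 3) ^ n) ^ n ≠ 0 := by positivity
  have p2 : (a * q ^ 2 / d ^ 2 * (q ^ 3) ^ n) ^ n ≠ 0 := by positivity
  clear flip hw hmain hcub hne h heK hde hbal
  obtain ⟨⟨n21, n22⟩, n23⟩ : (_ ∧ _) ∧ _ := by simpa only [mul_ne_zero_iff] using n2
  obtain ⟨⟨n51, n52⟩, n53⟩ : (_ ∧ _) ∧ _ := by simpa only [mul_ne_zero_iff] using n5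
  clear n2 n5
  generalize (-1) ^ n * (q ^ 3) ^ ((n + 1).choose 2) = s at *
  generalize (a * q * (q ^ 3) ^ n) ^ n = t₁ at *
  generalize (a * q ^ 2 / d ^ 2 * (q ^ 3) ^ n) ^ n = t₂ at *
  generalize (a * q / d * (q ^ 3) ^ n) ^ n = t₃ at *
  generalize (a * q ^ 2 / d * (q ^ 3) ^ n) ^ n = t₄ at *
  generalize efac E (q ^ 3) (a * d * q ^ 2 / e) n = y₁ at *
  generalize efac E (q ^ 3) (a * q ^ 3 / (d * e)) n = y₂ at *
  generalize efac E (q ^ 3) (a * q ^ 3 / e) n = y₃ at *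
  generalize efac E (q ^ 3) (a * q ^ 2 / e) n = y₄ at *
  generalize efac E (q ^ 3) (a * q) n = x₁ at *
  generalize efac E (q ^ 3) (a * q ^ 2 / d ^ 2) n = x₂ at *
  generalize efac E (q ^ 3) (a * q / d) n = x₃ at *
  generalize efac E (q ^ 3) (a * q ^ 2 / d) n = x₄ at *
  generalize efac E (q ^ 3) (a * q ^ 2) n = x₅ at *
  generalize efac E (q ^ 3) (a * q ^ 3) n = x₆ at *
  generalize efac E (q ^ 3) (a * q ^ 3 / d) n = x₇ at *
  generalize efac E (q ^ 3) (a * d * q ^ 2) n = x₈ at *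
  generalize efac E (q ^ 3) (q ^ 3) n = x₉ at *
  generalize efac E (q ^ 3) (a ^ 2 * q / d) n = z at *
  have key : y₁ * y₂ * (x₃ * x₄) = x₁ * x₂ * (y₃ * y₄) := by
    apply mul_left_cancel₀ (show s * s * (t₁ * t₂) ≠ 0 by positivity)
    calc _ = (y₂ * t₁) * (y₁ * t₂) * ((s * x₃) * (s * x₄)) := by ring
      _ = (s * x₁) * (s * x₂) * ((y₃ * t₃) * (y₄ * t₄)) := by rw [g1, g2, g3, g4]
      _ = _ := by linear_combination (-s * s * x₁ * x₂ * y₃ * y₄) * hpow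
  rw [div_mul_div_comm, div_eq_div_iff (by positivity) (by positivity)]
  linear_combination (-z * x₅ * x₆ * x₇ * x₈ * x₉) * key

/-- The cubic transformation with `f = a / e`, for generic parameters. -/
theorem cubic_transform_right (hE : IsTheta E) (hq : q ≠ 0) (ha : a ≠ 0) (hb : b ≠ 0) (hc : c ≠ 0)
    (hd : d ≠ 0) (hbal : b * c * d = a * q) {n : ℕ}
    (hde : d * e = a ^ 2 * q ^ (3 * n + 1)) (h : Generic E q a b d n) :
    ∑ k ∈ Finset.range (n + 1), cubicSummand E q a b c d e n k =
      efac E (q ^ 3) (a * q ^ 3) n * efac E (q ^ 3) (a * d * q ^ 2 / e) n *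
          efac E (q ^ 3) (c * q ^ 2) n * efac E (q ^ 3) (a ^ 2 * q ^ 3 / (c * d * e)) n /
        (efac E (q ^ 3) (a * q ^ 3 / b) n * efac E (q ^ 3) (a ^ 2 * q ^ 3 / (c * e)) n *
          efac E (q ^ 3) (a * q ^ 3 / d) n * efac E (q ^ 3) (a * q ^ 2 / e) n) *
      ∑ j ∈ Finset.range (n + 1), stdTerm E (q ^ 3) (a ^ 2 / (c * e)) (a / e) (a * q ^ 3 / (c * e))
        b d (a / c) (d * q) ((q ^ 3) ^ n)⁻¹ j := by
  have hne := fun i j l i' j' l' M M' x =>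
    Generic.ne_zero h hq ha hb hd i j l i' j' l' M M' (x := x)
  have hq3 : q ^ 3 ≠ 0 := pow_ne_zero 3 hq
  have heK : e = a ^ 2 * q / d * (q ^ 3) ^ n := by field_simp; linear_combination hde
  have hcK : c = a * q / (b * d) := by field_simp; linear_combination hbal
  have he : e ≠ 0 := by rw [heK]; positivity
  have hten : TenNonzero E (q ^ 3) (a * d / q) (a / b) (d * q ^ 2) e d (a / c) (a ^ 2 / (c * e))
      n := by
    refine ⟨h.q_ne, fun m _ => ?_, fun m _ => ?_, fun m _ => ?_, fun m _ => ?_, fun m _ => ?_,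
      fun m _ => ?_, fun m _ => ?_, fun m _ => ?_, fun m _ => ?_⟩
    · exact hne 1 0 1 0 0 0 (3 * m) 1 _ (by field_simp; ring) (by simp)
    · exact hne 0 1 2 1 0 0 (3 * m) (3 * n + 2) _ (by rw [hcK, heK]; field_simp; ring) (by simp)
    · exact hne 0 1 1 0 0 0 (3 * m + 2) 0 _ (by field_simp; ring) (by simp)
    · exact hne 1 0 0 0 0 0 (3 * m) 0 _ (by field_simp; ring) (by simp)
    · exact hne 0 0 2 1 0 0 (3 * m + 1) (3 * n) _ (by rw [heK]; field_simp; ring) (by simp)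
    · exact hne 1 0 0 0 0 0 (3 * m + 2) 0 _ (by field_simp; ring) (by simp)
    · exact hne 1 0 0 0 1 0 (3 * m + 3) 0 _ (by rw [hcK]; field_simp; ring) (by simp)
    · exact hne 0 1 1 1 0 0 (3 * m + 1) (3 * n) _ (by rw [hcK, heK]; field_simp; ring) (by simp)
    · exact hne 0 0 1 1 0 0 (3 * m + 2) (3 * n) _ (by rw [heK]; field_simp; ring) (by simp)
  have n1 : efac E (q ^ 3) (d * q / (q ^ 3) ^ n) n ≠ 0 := efac_ne_zero fun m _ =>
    hne 0 0 1 0 0 0 (3 * m + 1) (3 * n) _ (by field_simp; ring) (by simp)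
  have n2 : efac E (q ^ 3) (a * d / q * q ^ 3 / (d * (a / c))) n ≠ 0 := efac_ne_zero fun m _ =>
    hne 1 0 0 0 1 1 (3 * m + 3) 0 _ (by rw [hcK]; field_simp; ring) (by simp)
  have n3 : efac E (q ^ 3) (a ^ 2 / (c * e) * q ^ 3 / (d * (a / c))) n ≠ 0 := efac_ne_zero fun m _ =>
    hne 0 0 0 1 0 0 (3 * m + 2) (3 * n) _ (by rw [heK]; field_simp; ring) (by simp)
  have ht := stdTerm_transform hE hq3 (a := a * d / q) (b := a / b) (c := d * q ^ 2) (d := e)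
    (f := d) (g := a / c) (h := d * q) (l := a ^ 2 / (c * e)) (by positivity) (by positivity)
    (by positivity) he hd (by positivity) (by rw [hcK]; field_simp) n
    (by field_simp; linear_combination hde) hten n1 n2 n3
  have hperm : ∀ j, stdTerm E (q ^ 3) (a * d / q) (a / b) (a / c) d (d * q) (d * q ^ 2) e
      ((q ^ 3) ^ n)⁻¹ j = stdTerm E (q ^ 3) (a * d / q) (a / b) (d * q ^ 2) e d (a / c) (d * q)
      ((q ^ 3) ^ n)⁻¹ j := fun j => by simp only [stdTerm]; ring
  rw [cubic_transform_left hE hq ha hb hc hd hbal hde h, Finset.sum_congr rfl fun j _ => hperm j, ht,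
    ← mul_assoc,
    show a ^ 2 / (c * e) * (a / b) / (a * d / q) = a / e by rw [hcK]; field_simp,
    show a ^ 2 / (c * e) * (d * q ^ 2) / (a * d / q) = a * q ^ 3 / (c * e) by field_simp,
    show a ^ 2 / (c * e) * e / (a * d / q) = b by rw [hcK]; field_simp]
  congr 1
  rw [show a * d / q * q ^ 3 / (d * (a / c)) = c * q ^ 2 by field_simp,
    show a ^ 2 / (c * e) * q ^ 3 / (d * (a / c)) = a * q ^ 3 / (d * e) by field_simp,
    show a ^ 2 / (c * e) * q ^ 3 / d = a ^ 2 * q ^ 3 / (c * d * e) by field_simp,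
    show a ^ 2 / (c * e) * q ^ 3 / (a / c) = a * q ^ 3 / e by field_simp,
    show a ^ 2 / (c * e) * q ^ 3 = a ^ 2 * q ^ 3 / (c * e) by field_simp,
    show a * d / q * q ^ 3 / d = a * q ^ 2 by field_simp,
    show a * d / q * q ^ 3 / (a / c) = a * q ^ 3 / b by rw [hcK]; field_simp,
    show a * d / q * q ^ 3 = a * d * q ^ 2 by field_simp]
  have m1 : efac E (q ^ 3) (a * q ^ 3 / (d * e)) n ≠ 0 := efac_ne_zero fun m _ =>
    hne 0 0 0 1 0 0 (3 * m + 2) (3 * n) _ (by rw [heK]; field_simp; ring) (by simp)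
  have m2 : efac E (q ^ 3) (a * q ^ 2) n ≠ 0 := efac_ne_zero fun m _ =>
    hne 1 0 0 0 0 0 (3 * m + 2) 0 _ (by field_simp; ring) (by simp)
  have m3 : efac E (q ^ 3) (a * q ^ 3 / e) n ≠ 0 := efac_ne_zero fun m _ =>
    hne 0 0 1 1 0 0 (3 * m + 2) (3 * n) _ (by rw [heK]; field_simp; ring) (by simp)
  have m4 : efac E (q ^ 3) (a * d * q ^ 2) n ≠ 0 := efac_ne_zero fun m _ =>
    hne 1 0 1 0 0 0 (3 * m + 2) 0 _ (by field_simp; ring) (by simp)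
  refine eq_of_eq_mul_inv_mul m1 m2 (eq_of_eq_mul_inv_mul m3 m4 ?_)
  ring

end GenericParameters

section Specialization

variable {E : ℂ → ℂ} {q a b c d e f : ℂ}

/-- The right-hand side of the cubic transformation. -/
noncomputable def cubicSeries (E : ℂ → ℂ) (q a b c d e f : ℂ) (n : ℕ) : ℂ :=
  efac E (q ^ 3) (a * q ^ 3) n * efac E (q ^ 3) (a ^ 2 * q ^ 3 / (b * c * e)) n *
      efac E (q ^ 3) (a ^ 2 * q ^ 3 / (b * d * e * f)) n *
      efac E (q ^ 3) (a * f * q ^ 3 / (c * d)) n /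
    (efac E (q ^ 3) (a ^ 2 * q ^ 3 / (b * e * f)) n * efac E (q ^ 3) (a * q ^ 3 * f / c) n *
      efac E (q ^ 3) (a * q ^ 3 / d) n * efac E (q ^ 3) (a ^ 2 * q ^ 3 / (b * c * d * e)) n) *
  ∑ j ∈ Finset.range (n + 1), stdTerm E (q ^ 3) (a * f / c) (a / c) (f * q ^ 3 / c)
    (b * e * f / a) d (d * q) f ((q ^ 3) ^ n)⁻¹ j

theorem stdTerm_perm_left (a b c d f g h z : ℂ) (j : ℕ) :
    stdTerm E q a b c d f g h z j = stdTerm E q a c g h d f b z j := by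
  simp only [stdTerm]; ring

theorem stdTerm_perm_right (a b c d f g h z : ℂ) (j : ℕ) :
    stdTerm E q a b c d f g h z j = stdTerm E q a g c d f h b z j := by
  simp only [stdTerm]; ring

theorem sum_cubicSummand (hE : IsTheta E) (hq : q ≠ 0) (ha : a ≠ 0) (hb : b ≠ 0) (hc : c ≠ 0)
    (hd : d ≠ 0) (hbal : b * c * d = a * q) {n : ℕ}
    (hde : d * e = a ^ 2 * q ^ (3 * n + 1)) (hf : f = a / b ∨ f = a / e)
    (h : Generic E q a b d n) :
    ∑ k ∈ Finset.range (n + 1), cubicSummand E q a b c d e n k =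
      cubicSeries E q a b c d e f n := by
  have he : e ≠ 0 := right_ne_zero_of_mul (a := d) (by rw [hde]; positivity)
  have hcK : c = a * q / (b * d) := by field_simp; linear_combination hbal
  have e1 : a ^ 2 * q ^ 3 / (b * c * e) = a * d * q ^ 2 / e := by rw [hcK]; field_simp
  have e2 : a ^ 2 * q ^ 3 / (b * c * d * e) = a * q ^ 2 / e := by rw [hcK]; field_simp
  rw [cubicSeries, e1, e2]
  rcases hf with rfl | rfl
  · rw [cubic_transform_left hE hq ha hb hc hd hbal hde h,
      show a ^ 2 * q ^ 3 / (b * d * e * (a / b)) = a * q ^ 3 / (d * e) by field_simp,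
      show a * (a / b) * q ^ 3 / (c * d) = a * q ^ 2 by rw [hcK]; field_simp,
      show a ^ 2 * q ^ 3 / (b * e * (a / b)) = a * q ^ 3 / e by field_simp,
      show a * q ^ 3 * (a / b) / c = a * d * q ^ 2 by rw [hcK]; field_simp,
      show a * (a / b) / c = a * d / q by rw [hcK]; field_simp,
      show a / b * q ^ 3 / c = d * q ^ 2 by rw [hcK]; field_simp,
      show b * e * (a / b) / a = e by field_simp]
    refine congrArg _ (Finset.sum_congr rfl fun j _ => stdTerm_perm_left ..)
  · rw [cubic_transform_right hE hq ha hb hc hd hbal hde h,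
      show a ^ 2 * q ^ 3 / (b * d * e * (a / e)) = c * q ^ 2 by rw [hcK]; field_simp,
      show a * (a / e) * q ^ 3 / (c * d) = a ^ 2 * q ^ 3 / (c * d * e) by field_simp,
      show a ^ 2 * q ^ 3 / (b * e * (a / e)) = a * q ^ 3 / b by field_simp,
      show a * q ^ 3 * (a / e) / c = a ^ 2 * q ^ 3 / (c * e) by field_simp,
      show a * (a / e) / c = a ^ 2 / (c * e) by field_simp,
      show a / e * q ^ 3 / c = a * q ^ 3 / (c * e) by field_simp,
      show b * e * (a / e) / a = b by field_simp]
    refine congrArg _ (Finset.sum_congr rfl fun j _ => stdTerm_perm_right ..)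

theorem continuousAt_efac {X : Type*} [TopologicalSpace X] {x : X → ℂ} {s : X}
    (hE : ∀ y ≠ 0, ContinuousAt E y) (hq : q ≠ 0) (hx : ContinuousAt x s) (h0 : x s ≠ 0) (n : ℕ) :
    ContinuousAt (fun t => efac E q (x t) n) s := by
  refine tendsto_finsetProd _ fun k _ => ?_
  exact (hE _ (by positivity)).comp (f := fun t => x t * q ^ k) (hx.mul continuousAt_const)

theorem efac_ne_zero_of_le {x : ℂ} {m n : ℕ} (h : efac E q x n ≠ 0) (hmn : m ≤ n) :
    efac E q x m ≠ 0 :=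
  efac_ne_zero fun _ hk => ne_zero_of_efac_ne_zero h (by omega)

/-- The perturbation of the parameters along which they are generic for all but countably many
values. -/
theorem dense_generic {p : ℂ} (hp : ‖p‖ < 1) (hq : q ≠ 0) (ha : a ≠ 0) (hb : b ≠ 0) (hd : d ≠ 0)
    {n : ℕ} (hqn : ∀ m < n, ellE (q ^ 3 * (q ^ 3) ^ m) p ≠ 0) :
    Dense {s : ℝ | Generic (fun x => ellE x p) q (a * Complex.exp s) (b * Complex.exp (10 * s))
      (d * Complex.exp (100 * s)) n} := by
  have key : ∀ i j l i' j' l' M M' : ℕ, i ≤ 2 → j ≤ 2 → l ≤ 2 → i' ≤ 2 → j' ≤ 2 → l' ≤ 2 →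
      (i ≠ i' ∨ j ≠ j' ∨ l ≠ l') →
      {s : ℝ | ellE ((a * Complex.exp s) ^ i * (b * Complex.exp (10 * s)) ^ j *
        (d * Complex.exp (100 * s)) ^ l * q ^ M / ((a * Complex.exp s) ^ i' *
        (b * Complex.exp (10 * s)) ^ j' * (d * Complex.exp (100 * s)) ^ l' * q ^ M')) p =
          0}.Countable := by
    intro i j l i' j' l' M M' hi hj hl hi' hj' hl' hne
    obtain ⟨w, hw⟩ : ∃ w : ℤ, w = i + 10 * j + 100 * l - (i' + 10 * j' + 100 * l') := ⟨_, rfl⟩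
    have hw0 : w ≠ 0 := by omega
    have hwc : (w : ℂ) = i + 10 * j + 100 * l - (i' + 10 * j' + 100 * l') := by
      rw [hw]; push_cast; ring
    set X := a ^ i * b ^ j * d ^ l * q ^ M / (a ^ i' * b ^ j' * d ^ l' * q ^ M') with hX
    have hX0 : X ≠ 0 := by positivity
    have hform : ∀ s : ℝ, (a * Complex.exp s) ^ i * (b * Complex.exp (10 * s)) ^ j *
        (d * Complex.exp (100 * s)) ^ l * q ^ M / ((a * Complex.exp s) ^ i' *
        (b * Complex.exp (10 * s)) ^ j' * (d * Complex.exp (100 * s)) ^ l' * q ^ M') =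
        X * ((Real.exp (w * s) : ℝ) : ℂ) := by
      intro s
      have : ((Real.exp (w * s) : ℝ) : ℂ) = Complex.exp (i * s) * Complex.exp (j * (10 * s)) *
          Complex.exp (l * (100 * s)) / (Complex.exp (i' * s) * Complex.exp (j' * (10 * s)) *
          Complex.exp (l' * (100 * s))) := by
        rw [Complex.ofReal_exp, ← Complex.exp_add, ← Complex.exp_add, ← Complex.exp_add,
          ← Complex.exp_add, ← Complex.exp_sub]
        push_cast
        rw [hwc]
        congr 1
        ring
      rw [this, hX]
      simp only [mul_pow, ← Complex.exp_nat_mul]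
      ring
    have hinj : Function.Injective fun s : ℝ => X * ((Real.exp (w * s) : ℝ) : ℂ) := by
      intro s t hst
      have h1 := Real.exp_injective (Complex.ofReal_injective (mul_left_cancel₀ hX0 hst))
      exact mul_left_cancel₀ (Int.cast_ne_zero.2 hw0) h1
    refine ((countable_ellE_zeros hp).preimage hinj).mono fun s hs => ?_
    refine ⟨mul_ne_zero hX0 (Complex.ofReal_ne_zero.2 (Real.exp_ne_zero _)), ?_⟩
    beta_reduce
    rw [← hform]
    exact hs
  refine (Set.Countable.dense_compl ℝ (s := ⋃ (i : ℕ) (j : ℕ) (l : ℕ) (i' : ℕ) (j' : ℕ) (l' : ℕ)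
    (M : ℕ) (M' : ℕ) (_ : i ≤ 2) (_ : j ≤ 2) (_ : l ≤ 2) (_ : i' ≤ 2) (_ : j' ≤ 2) (_ : l' ≤ 2)
    (_ : i ≠ i' ∨ j ≠ j' ∨ l ≠ l'), {s : ℝ | ellE ((a * Complex.exp s) ^ i *
      (b * Complex.exp (10 * s)) ^ j * (d * Complex.exp (100 * s)) ^ l * q ^ M /
      ((a * Complex.exp s) ^ i' * (b * Complex.exp (10 * s)) ^ j' *
      (d * Complex.exp (100 * s)) ^ l' * q ^ M')) p = 0}) ?_).mono ?_
  · refine Set.countable_iUnion fun i => Set.countable_iUnion fun j => Set.countable_iUnion fun l =>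
      Set.countable_iUnion fun i' => Set.countable_iUnion fun j' => Set.countable_iUnion fun l' =>
      Set.countable_iUnion fun M => Set.countable_iUnion fun M' => ?_
    exact Set.countable_iUnion fun h1 => Set.countable_iUnion fun h2 => Set.countable_iUnion fun h3 =>
      Set.countable_iUnion fun h4 => Set.countable_iUnion fun h5 => Set.countable_iUnion fun h6 =>
      Set.countable_iUnion fun h7 => key i j l i' j' l' M M' h1 h2 h3 h4 h5 h6 h7
  · intro s hs
    refine ⟨hqn, fun i j l i' j' l' M M' h1 h2 h3 h4 h5 h6 h7 h0 => hs ?_⟩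
    simp only [Set.mem_iUnion]
    exact ⟨i, j, l, i', j', l', M, M', h1, h2, h3, h4, h5, h6, h7, h0⟩

theorem continuousAt_stdTerm {a b c d f g h z : ℝ → ℂ} {s : ℝ} {n j : ℕ}
    (hE : ∀ y ≠ 0, ContinuousAt E y) (hq : q ≠ 0)
    (ca : ContinuousAt a s) (cb : ContinuousAt b s) (cc : ContinuousAt c s) (cd : ContinuousAt d s)
    (cf : ContinuousAt f s) (cg : ContinuousAt g s) (ch : ContinuousAt h s) (cz : ContinuousAt z s)
    (ha : a s ≠ 0) (hb : b s ≠ 0) (hc : c s ≠ 0) (hd : d s ≠ 0) (hf : f s ≠ 0) (hg : g s ≠ 0)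
    (hh : h s ≠ 0) (hz : z s ≠ 0) (hj : j ≤ n) (hEa : E (a s) ≠ 0)
    (hden : efac E q q n * efac E q (a s * q / b s) n * efac E q (a s * q / c s) n *
      efac E q (a s * q / d s) n * efac E q (a s * q / f s) n * efac E q (a s * q / g s) n *
        efac E q (a s * q / h s) n * efac E q (a s * q / z s) n ≠ 0) :
    ContinuousAt (fun t => stdTerm E q (a t) (b t) (c t) (d t) (f t) (g t) (h t) (z t) j) s := by
  simp only [mul_ne_zero_iff] at hden
  obtain ⟨⟨⟨⟨⟨⟨⟨h1, h2⟩, h3⟩, h4⟩, h5⟩, h6⟩, h7⟩, h8⟩ := hden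
  have caq : ContinuousAt (fun t => a t * q) s := ca.mul continuousAt_const
  have num := fun {x : ℝ → ℂ} (cx : ContinuousAt x s) (hx : x s ≠ 0) =>
    continuousAt_efac hE hq cx hx j
  have den := fun {x : ℝ → ℂ} (cx : ContinuousAt x s) (hx : x s ≠ 0) =>
    continuousAt_efac hE hq (caq.div cx hx) (div_ne_zero (mul_ne_zero ha hq) hx) j
  have hle := fun {x : ℂ} (hx : efac E q x n ≠ 0) => efac_ne_zero_of_le hx hj
  refine ContinuousAt.mul (ContinuousAt.div ?_ ((hE _ ha).comp ca) hEa) (ContinuousAt.div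
    ((((((((num ca ha).mul (num cb hb)).mul (num cc hc)).mul (num cd hd)).mul (num cf hf)).mul
      (num cg hg)).mul (num ch hh)).mul (num cz hz) |>.mul continuousAt_const)
    (((((((continuousAt_const.mul (den cb hb)).mul (den cc hc)).mul (den cd hd)).mul (den cf hf)).mul
      (den cg hg)).mul (den ch hh)).mul (den cz hz)) ?_)
  · exact (hE _ (by positivity)).comp (f := fun t => a t * q ^ (2 * j)) (ca.mul continuousAt_const)
  · simp only [mul_ne_zero_iff]
    exact ⟨⟨⟨⟨⟨⟨⟨hle h1, hle h2⟩, hle h3⟩, hle h4⟩, hle h5⟩, hle h6⟩, hle h7⟩, hle h8⟩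

theorem continuousAt_cubicSummand {a b c d e : ℝ → ℂ} {s : ℝ} {n k : ℕ}
    (hE : ∀ y ≠ 0, ContinuousAt E y) (hq : q ≠ 0)
    (ca : ContinuousAt a s) (cb : ContinuousAt b s) (cc : ContinuousAt c s) (cd : ContinuousAt d s)
    (ce : ContinuousAt e s) (ha : a s ≠ 0) (hb : b s ≠ 0) (hc : c s ≠ 0) (hd : d s ≠ 0)
    (he : e s ≠ 0) (hk : k ≤ n) (hEa : E (a s) ≠ 0)
    (h1 : efac E (q ^ 3) (a s * q ^ 3 / b s) n ≠ 0) (h2 : efac E (q ^ 3) (a s * q ^ 3 / c s) n ≠ 0)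
    (h3 : efac E q (a s * q / d s) (2 * n) ≠ 0) (h4 : efac E q (a s * q / e s) n ≠ 0)
    (h5 : efac E q (a s * q ^ (3 * n + 1)) n ≠ 0) :
    ContinuousAt (fun t => cubicSummand E q (a t) (b t) (c t) (d t) (e t) n k) s := by
  have hq3 : q ^ 3 ≠ 0 := pow_ne_zero 3 hq
  have caq : ∀ m : ℕ, ContinuousAt (fun t => a t * q ^ m) s := fun m => ca.mul continuousAt_const
  have caq1 : ContinuousAt (fun t => a t * q) s := ca.mul continuousAt_const
  refine (((ContinuousAt.div ((hE _ (by positivity)).comp (caq (4 * k))) ((hE _ ha).comp ca)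
    hEa).mul (ContinuousAt.div ?_ ?_ ?_)).mul (ContinuousAt.div ?_ ?_ ?_)).mul
    (ContinuousAt.div ?_ ?_ ?_) |>.mul continuousAt_const
  · exact (continuousAt_efac hE hq cb hb k).mul (continuousAt_efac hE hq cc hc k)
  · exact (continuousAt_efac hE hq3 ((caq 3).div cb hb) (by simp only [Pi.div_apply]; positivity) k).mul
      (continuousAt_efac hE hq3 ((caq 3).div cc hc) (by simp only [Pi.div_apply]; positivity) k)
  · exact mul_ne_zero (efac_ne_zero_of_le h1 hk) (efac_ne_zero_of_le h2 hk)
  · exact continuousAt_efac hE hq cd hd _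
  · exact continuousAt_efac hE hq (caq1.div cd hd) (by simp only [Pi.div_apply]; positivity) _
  · exact efac_ne_zero_of_le h3 (by omega)
  · exact (continuousAt_efac hE hq3 ce he k).mul continuousAt_const
  · exact (continuousAt_efac hE hq (caq1.div ce he) (by simp only [Pi.div_apply]; positivity) k).mul
      (continuousAt_efac hE hq (caq _) (by positivity) k)
  · exact mul_ne_zero (efac_ne_zero_of_le h4 hk) (efac_ne_zero_of_le h5 hk)

theorem continuousAt_cubicSeries {a b c d e f : ℝ → ℂ} {s : ℝ} {n : ℕ}
    (hE : ∀ y ≠ 0, ContinuousAt E y) (hq : q ≠ 0)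
    (ca : ContinuousAt a s) (cb : ContinuousAt b s) (cc : ContinuousAt c s) (cd : ContinuousAt d s)
    (ce : ContinuousAt e s) (cf : ContinuousAt f s) (ha : a s ≠ 0) (hb : b s ≠ 0) (hc : c s ≠ 0)
    (hd : d s ≠ 0) (he : e s ≠ 0) (hf : f s ≠ 0) (hEa : E (a s * f s / c s) ≠ 0)
    (hpref : efac E (q ^ 3) (a s ^ 2 * q ^ 3 / (b s * e s * f s)) n *
      efac E (q ^ 3) (a s * q ^ 3 * f s / c s) n * efac E (q ^ 3) (a s * q ^ 3 / d s) n *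
        efac E (q ^ 3) (a s ^ 2 * q ^ 3 / (b s * c s * d s * e s)) n ≠ 0)
    (hden : efac E (q ^ 3) (q ^ 3) n * efac E (q ^ 3) (a s * f s / c s * q ^ 3 / (a s / c s)) n *
      efac E (q ^ 3) (a s * f s / c s * q ^ 3 / (f s * q ^ 3 / c s)) n *
      efac E (q ^ 3) (a s * f s / c s * q ^ 3 / (b s * e s * f s / a s)) n *
      efac E (q ^ 3) (a s * f s / c s * q ^ 3 / d s) n *
      efac E (q ^ 3) (a s * f s / c s * q ^ 3 / (d s * q)) n *
      efac E (q ^ 3) (a s * f s / c s * q ^ 3 / f s) n *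
      efac E (q ^ 3) (a s * f s / c s * q ^ 3 / ((q ^ 3) ^ n)⁻¹) n ≠ 0) :
    ContinuousAt (fun t => cubicSeries E q (a t) (b t) (c t) (d t) (e t) (f t) n) s := by
  have hq3 : q ^ 3 ≠ 0 := pow_ne_zero 3 hq
  have cK := fun {x : ℂ} => continuousAt_const (x := s) (y := x)
  have efc := fun {x : ℝ → ℂ} (cx : ContinuousAt x s) (hx : x s ≠ 0) =>
    continuousAt_efac hE hq3 cx hx n
  have c2 : ContinuousAt (fun t => a t ^ 2 * q ^ 3) s := (ca.pow 2).mul cK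
  have c3 : ContinuousAt (fun t => a t * q ^ 3) s := ca.mul cK
  have c4 : ContinuousAt (fun t => a t ^ 2 * q ^ 3 / (b t * c t * e t)) s :=
    c2.div ((cb.mul cc).mul ce) (mul_ne_zero (mul_ne_zero hb hc) he)
  have c5 : ContinuousAt (fun t => a t ^ 2 * q ^ 3 / (b t * d t * e t * f t)) s :=
    c2.div (((cb.mul cd).mul ce).mul cf) (mul_ne_zero (mul_ne_zero (mul_ne_zero hb hd) he) hf)
  have c6 : ContinuousAt (fun t => a t * f t * q ^ 3 / (c t * d t)) s :=
    ((ca.mul cf).mul cK).div (cc.mul cd) (mul_ne_zero hc hd)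
  have c7 : ContinuousAt (fun t => a t ^ 2 * q ^ 3 / (b t * e t * f t)) s :=
    c2.div ((cb.mul ce).mul cf) (mul_ne_zero (mul_ne_zero hb he) hf)
  have c8 : ContinuousAt (fun t => a t * q ^ 3 * f t / c t) s := (c3.mul cf).div cc hc
  have c9 : ContinuousAt (fun t => a t * q ^ 3 / d t) s := c3.div cd hd
  have c10 : ContinuousAt (fun t => a t ^ 2 * q ^ 3 / (b t * c t * d t * e t)) s :=
    c2.div (((cb.mul cc).mul cd).mul ce) (mul_ne_zero (mul_ne_zero (mul_ne_zero hb hc) hd) he)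
  refine ContinuousAt.mul (ContinuousAt.div
    ((((efc c3 (by positivity)).mul (efc c4 (by positivity))).mul (efc c5 (by positivity))).mul
      (efc c6 (by positivity)))
    ((((efc c7 (by positivity)).mul (efc c8 (by positivity))).mul (efc c9 (by positivity))).mul
      (efc c10 (by positivity))) hpref)
    (tendsto_finsetSum _ fun j hj => continuousAt_stdTerm (n := n) hE hq3
      ((ca.mul cf).div cc hc) (ca.div cc hc) ((cf.mul cK).div cc hc) (((cb.mul ce).mul cf).div ca ha)
      cd (cd.mul cK) cf cK ?_ ?_ ?_ ?_ hd ?_ hf ?_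
      (by simpa [Nat.lt_succ_iff] using hj) hEa hden) <;> positivity

/-- The cubic transformation, as an identity of finite sums. -/
theorem sum_cubicSummand_of_ne_zero {p : ℂ} (hp : ‖p‖ < 1) (hq : q ≠ 0) (ha : a ≠ 0) {n : ℕ}
    (hbal : b * c * d = a * q) (hde : d * e = a ^ 2 * q ^ (3 * n + 1)) (hf : f = a / b ∨ f = a / e)
    (hEa : ellE a p ≠ 0)
    (h1 : ellFac (a * q ^ 3 / b) (q ^ 3) p n ≠ 0) (h2 : ellFac (a * q ^ 3 / c) (q ^ 3) p n ≠ 0)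
    (h3 : ellFac (a * q / d) q p (2 * n) ≠ 0) (h4 : ellFac (a * q / e) q p n ≠ 0)
    (h5 : ellFac (a * q ^ (3 * n + 1)) q p n ≠ 0) (hEl : ellE (a * f / c) p ≠ 0)
    (hpref : ellFac (a ^ 2 * q ^ 3 / (b * e * f)) (q ^ 3) p n *
      ellFac (a * q ^ 3 * f / c) (q ^ 3) p n * ellFac (a * q ^ 3 / d) (q ^ 3) p n *
        ellFac (a ^ 2 * q ^ 3 / (b * c * d * e)) (q ^ 3) p n ≠ 0)
    (hden : ellFac (q ^ 3) (q ^ 3) p n * ellFac (a * f / c * q ^ 3 / (a / c)) (q ^ 3) p n *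
      ellFac (a * f / c * q ^ 3 / (f * q ^ 3 / c)) (q ^ 3) p n *
      ellFac (a * f / c * q ^ 3 / (b * e * f / a)) (q ^ 3) p n *
      ellFac (a * f / c * q ^ 3 / d) (q ^ 3) p n *
      ellFac (a * f / c * q ^ 3 / (d * q)) (q ^ 3) p n *
      ellFac (a * f / c * q ^ 3 / f) (q ^ 3) p n *
      ellFac (a * f / c * q ^ 3 / ((q ^ 3) ^ n)⁻¹) (q ^ 3) p n ≠ 0) :
    ∑ k ∈ Finset.range (n + 1), cubicSummand (fun x => ellE x p) q a b c d e n k =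
      cubicSeries (fun x => ellE x p) q a b c d e f n := by
  have hbcd : b * c * d ≠ 0 := by rw [hbal]; positivity
  obtain ⟨⟨hb, hc⟩, hd⟩ : (b ≠ 0 ∧ c ≠ 0) ∧ d ≠ 0 := by simpa only [mul_ne_zero_iff] using hbcd
  have he : e ≠ 0 := right_ne_zero_of_mul (a := d) (by rw [hde]; positivity)
  have hf0 : f ≠ 0 := by rcases hf with rfl | rfl <;> positivity
  have hqn : ∀ m < n, ellE (q ^ 3 * (q ^ 3) ^ m) p ≠ 0 := fun m hm =>
    ne_zero_of_efac_ne_zero (E := fun x => ellE x p) (left_ne_zero_of_mul (left_ne_zero_of_mul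
      (left_ne_zero_of_mul (left_ne_zero_of_mul (left_ne_zero_of_mul (left_ne_zero_of_mul
        (left_ne_zero_of_mul hden))))))) hm
  have hE : ∀ y ≠ 0, ContinuousAt (fun x => ellE x p) y := fun y hy => continuousAt_ellE hp hy
  have hexp : ∀ w : ℂ, ContinuousAt (fun s : ℝ => Complex.exp (w * s)) 0 := fun w => by fun_prop
  have ce1 : ContinuousAt (fun s : ℝ => Complex.exp s) 0 := by fun_prop
  set A : ℝ → ℂ := fun s => a * Complex.exp s with hA
  set B : ℝ → ℂ := fun s => b * Complex.exp (10 * s) with hB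
  set D : ℝ → ℂ := fun s => d * Complex.exp (100 * s) with hD
  set C : ℝ → ℂ := fun s => A s * q / (B s * D s) with hC
  set F : ℝ → ℂ := fun s => A s ^ 2 * q ^ (3 * n + 1) / D s with hF
  have A0 : ∀ s, A s ≠ 0 := fun s => mul_ne_zero ha (Complex.exp_ne_zero _)
  have B0 : ∀ s, B s ≠ 0 := fun s => mul_ne_zero hb (Complex.exp_ne_zero _)
  have D0 : ∀ s, D s ≠ 0 := fun s => mul_ne_zero hd (Complex.exp_ne_zero _)
  have C0 : ∀ s, C s ≠ 0 := fun s =>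
    div_ne_zero (mul_ne_zero (A0 s) hq) (mul_ne_zero (B0 s) (D0 s))
  have F0 : ∀ s, F s ≠ 0 := fun s =>
    div_ne_zero (mul_ne_zero (pow_ne_zero 2 (A0 s)) (pow_ne_zero _ hq)) (D0 s)
  have cA : ContinuousAt A 0 := continuousAt_const.mul ce1
  have cB : ContinuousAt B 0 := continuousAt_const.mul (hexp 10)
  have cD : ContinuousAt D 0 := continuousAt_const.mul (hexp 100)
  have cC : ContinuousAt C 0 :=
    (cA.mul continuousAt_const).div (cB.mul cD) (mul_ne_zero (B0 0) (D0 0))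
  have cF : ContinuousAt F 0 := ((cA.pow 2).mul continuousAt_const).div cD (D0 0)
  obtain ⟨G, cG, G0, hG⟩ : ∃ G : ℝ → ℂ, ContinuousAt G 0 ∧ G 0 = f ∧
      ∀ s, G s = A s / B s ∨ G s = A s / F s := by
    rcases hf with rfl | rfl
    · exact ⟨fun s => A s / B s, cA.div cB (B0 0), by simp [hA, hB], fun s => Or.inl rfl⟩
    · refine ⟨fun s => A s / F s, cA.div cF (F0 0), ?_, fun s => Or.inr rfl⟩
      simp only [hA, hF, hD, Complex.ofReal_zero, mul_zero, Complex.exp_zero, mul_one]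
      rw [← hde, mul_div_cancel_left₀ _ hd]
  have vA : A 0 = a := by simp [hA]
  have vB : B 0 = b := by simp [hB]
  have vD : D 0 = d := by simp [hD]
  have vC : C 0 = c := by
    simp only [hC, vA, vB, vD]
    rw [← hbal]
    field_simp
  have vF : F 0 = e := by simp only [hF, vA, vD]; rw [← hde, mul_div_cancel_left₀ _ hd]
  have hbal' : ∀ s, B s * C s * D s = A s * q := fun s => by
    have := B0 s
    have := D0 s
    simp only [hC]
    field_simp
  have hd := dense_generic hp hq ha hb hd hqn
  have := mem_closure_iff_nhdsWithin_neBot.1 (hd 0)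
  have hlim := tendsto_nhds_unique_of_eventuallyEq
    (f := fun s => ∑ k ∈ Finset.range (n + 1),
      cubicSummand (fun x => ellE x p) q (A s) (B s) (C s) (D s) (F s) n k)
    (g := fun s => cubicSeries (fun x => ellE x p) q (A s) (B s) (C s) (D s) (F s) (G s) n)
    (l := 𝓝[{s : ℝ | Generic (fun x => ellE x p) q (A s) (B s) (D s) n}] 0)
    (Tendsto.mono_left (tendsto_finsetSum _ fun k hk => continuousAt_cubicSummand (n := n) hE hq
      cA cB cC cD cF (A0 0) (B0 0) (C0 0) (D0 0) (F0 0)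
      (by simpa [Nat.lt_succ_iff] using hk) (by rwa [vA]) (by rwa [vA, vB]) (by rwa [vA, vC])
      (by rwa [vA, vD]) (by rwa [vA, vF]) (by rwa [vA])) nhdsWithin_le_nhds)
    (Tendsto.mono_left (continuousAt_cubicSeries hE hq cA cB cC cD cF cG (A0 0) (B0 0) (C0 0)
      (D0 0) (F0 0) (by rwa [G0]) (by rwa [vA, G0, vC]) (by rwa [vA, vB, vF, G0, vC, vD])
      (by rwa [vA, vB, vF, G0, vC, vD])) nhdsWithin_le_nhds)
    (eventually_nhdsWithin_of_forall fun s hs => sum_cubicSummand (isTheta_ellE hp) hq (A0 s) (B0 s)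
      (C0 s) (D0 s) (hbal' s) (mul_div_cancel₀ _ (D0 s)) (hG s) hs)
  simpa only [vA, vB, vC, vD, vF, G0] using hlim

theorem ellFac_inv_pow_eq_zero {p x : ℂ} (hx : x ≠ 0) {n k : ℕ} (hp : ‖p‖ < 1) (hk : n < k) :
    ellFac (x ^ n)⁻¹ x p k = 0 :=
  Finset.prod_eq_zero (Finset.mem_range.2 hk)
    (by rw [inv_mul_cancel₀ (pow_ne_zero n hx)]; exact (isTheta_ellE hp).one)

end Specialization

theorem mainTheorem3 (n : ℕ) (p q a b c d e f : ℂ)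
    (hp : ‖p‖ < 1) (hq : q ≠ 0) (ha : a ≠ 0)
    (hbcd : b * c * d = a * q)
    (hde : d * e = a ^ 2 * q ^ (3 * n + 1))
    (hf : f = a / b ∨ f = a / e)
    -- no denominator on the left-hand side vanishes
    -- (nonvanishing at the top index `n` is nonvanishing at every index `k ≤ n`)
    (hL₀ : ellE a p ≠ 0)
    (hL₁ : ellFacs [a * q ^ 3 / b, a * q ^ 3 / c] (q ^ 3) p n ≠ 0)
    (hL₂ : ellFac (a * q / d) q p (2 * n) ≠ 0)
    (hL₃ : ellFacs [a * q / e, a * q ^ (3 * n + 1)] q p n ≠ 0)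
    -- the denominator of the prefactor on the right-hand side does not vanish
    (hR₀ : ellFacs [a ^ 2 * q ^ 3 / (b * e * f), a * q ^ 3 * f / c, a * q ^ 3 / d,
      a ^ 2 * q ^ 3 / (b * c * d * e)] (q ^ 3) p n ≠ 0)
    -- no denominator of the first `n + 1` terms of the series on the right-hand side vanishes
    (hR₁ : ellE (a * f / c) p ≠ 0)
    (hR₂ : ellFacs (q ^ 3 :: [a / c, f * q ^ 3 / c, b * e * f / a, d, d * q, f,
      q ^ (-(3 * n : ℤ))].map fun x => a * f / c * q ^ 3 / x) (q ^ 3) p n ≠ 0) :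
    ∑ k ∈ Finset.range (n + 1),
        ellE (a * q ^ (4 * k)) p / ellE a p *
        (ellFacs [b, c] q p k / ellFacs [a * q ^ 3 / b, a * q ^ 3 / c] (q ^ 3) p k) *
        (ellFac d q p (2 * k) / ellFac (a * q / d) q p (2 * k)) *
        (ellFacs [e, q ^ (-(3 * n : ℤ))] (q ^ 3) p k /
          ellFacs [a * q / e, a * q ^ (3 * n + 1)] q p k) * q ^ k
      = ellFacs [a * q ^ 3, a ^ 2 * q ^ 3 / (b * c * e), a ^ 2 * q ^ 3 / (b * d * e * f),
            a * f * q ^ 3 / (c * d)] (q ^ 3) p n /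
          ellFacs [a ^ 2 * q ^ 3 / (b * e * f), a * q ^ 3 * f / c, a * q ^ 3 / d,
            a ^ 2 * q ^ 3 / (b * c * d * e)] (q ^ 3) p n *
        ellOmega (a * f / c)
          [a / c, f * q ^ 3 / c, b * e * f / a, d, d * q, f, q ^ (-(3 * n : ℤ))] (q ^ 3) p := by
  have hz : q ^ (-(3 * n : ℤ)) = ((q ^ 3) ^ n)⁻¹ := by
    rw [zpow_neg, ← pow_mul]
    norm_cast
  have hEO : ellOmega (a * f / c) [a / c, f * q ^ 3 / c, b * e * f / a, d, d * q, f,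
      q ^ (-(3 * n : ℤ))] (q ^ 3) p = ∑ j ∈ Finset.range (n + 1), stdTerm (fun x => ellE x p) (q ^ 3)
        (a * f / c) (a / c) (f * q ^ 3 / c) (b * e * f / a) d (d * q) f ((q ^ 3) ^ n)⁻¹ j := by
    rw [hz, ellOmega, tsum_eq_sum (s := Finset.range (n + 1))]
    · refine Finset.sum_congr rfl fun j _ => ?_
      simp only [ellFacs, List.map_cons, List.map_nil, List.prod_cons, List.prod_nil, mul_one,
        stdTerm, ← mul_assoc]
      rfl
    · intro k hk
      simp [ellFacs, ellFac_inv_pow_eq_zero (pow_ne_zero 3 hq) hp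
        (show n < k by simpa [Nat.lt_succ_iff] using hk)]
  simp only [hz, ellFacs, List.map_cons, List.map_nil, List.prod_cons, List.prod_nil, mul_one,
    ← mul_assoc] at hL₁ hL₃ hR₀ hR₂
  have h := sum_cubicSummand_of_ne_zero hp hq ha hbcd hde hf hL₀ (left_ne_zero_of_mul hL₁)
    (right_ne_zero_of_mul hL₁) hL₂ (left_ne_zero_of_mul hL₃) (right_ne_zero_of_mul hL₃) hR₁ hR₀ hR₂
  rw [hEO, hz]
  simp only [ellFacs, List.map_cons, List.map_nil, List.prod_cons, List.prod_nil, mul_one,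
    ← mul_assoc]
  simp only [cubicSummand, cubicSeries] at h
  exact h
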